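/- Let $W=\mathcal S_n$ be the symmetric group on $\{1,\dots,n\}$ with simple reflections $S=\{s_1,\dots,s_{n-1}\}$, $s_i=(i\;\,i+1)$, and length function $\ell$. For $I\subset S$ let $W_I$ be the parabolic subgroup generated by $I$, $w_I$ its longest element, and $\ell(I)=\ell(w_I)$. An $(I,J)$-coset is an element $p$ of $W_I\backslash W/W_J$; $\underline p$ and $\overline p$ denote its minimal and maximal elements in the Bruhat order. It is a *core coset* if $I=I\cap\underline pJ\underline p^{-1}$ and $J=\underline p^{-1}I\underline p\cap J$. An $(I,J)$-expression is a sequence $[[I=I_0\subset K_1\supset I_1\subset\dots\subset K_d\supset I_d=J]]$ of subsets of $S$ ($d\ge 0$); it is a *reduced expression* of the $(I,J)$-coset $p$ if $\overline p=w_{K_1}w_{I_1}^{-1}w_{K_2}\cdots w_{K_d}$ and $\ell(\overline p)=\ell(K_1)-\ell(I_1)+\ell(K_2)-\dots+\ell(K_d)$ (read as $\overline p = w_I$, $\ell(\overline p)=\ell(I)$ when $d=0$). A core $(I,J)$-coset is *atomic* if $J=(I\cup\{s\})\setminus\{t\}$ for some $s\in S\setminus I$, $t\in I\cup\{s\}$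 and $[[I\subset I\cup\{s\}\supset J]]$ is a reduced expression of it. An *atomic reduced expression* of $p$ is a reduced expression of $p$ each of whose steps $[[I_{i-1}\subset K_i\supset I_i]]$ is a reduced expression of an atomic $(I_{i-1},I_i)$-coset $p_i$. For $p\in W_I\backslash W/W_J$ and $q\in W_J\backslash W/W_K$ write $r=p.q$ if $\overline p*\overline q=(\overline pw_J^{-1})\overline q=\overline p(w_J^{-1}\overline q)$, where $*$ is the product of the Coxeter monoid ($0$-Hecke monoid) of $W$, if the lengths add in both of these products of group elements, and if $r=W_I(\overline p*\overline q)W_K$. In a Coxeter group, $x.y$ denotes the product $xy$ under the condition $\ell(xy)=\ell(x)+\ell(y)$. For $J\subset S$ let $\sim_J$ be the equivalence relation on $\{1,\dots,n\}$ generated by $j\sim_J j+1$ for $s_j\in J$. If $\#J=m$, it has $n-m$ classes, the *components* of $J$, which are intervals; they are numbered $1,\dots,n-m$ from left to right. Fix $m$. Then: 1. If $p$ is a core $(I,J)$-coset with $\#J=m$, then $\#I=m$, and $\underline p$ maps each component of $J$ onto a component of $I$ by an order-preserving bijection. So there is exactly one permutation $\mathbb Sq(p)\in\mathcal S_{n-m}$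 (the *squashed permutation*) such that $\underline p$ maps the component of $J$ with number $c$ onto the component of $I$ with number $\mathbb Sq(p)(c)$. 2. If $p$ is a core $(I,J)$-coset with $\#J=m$, then sending an atomic reduced expression with steps expressing $p_1,\dots,p_d$ to $(\mathbb Sq(p_1),\dots,\mathbb Sq(p_d))$ is a bijection $$\{\text{atomic reduced expressions of }p\}\longrightarrow\{\text{ordinary reduced expressions of }\mathbb Sq(p)\text{ in }\mathcal S_{n-m}\}.$$ 3. If $p$ is an atomic $(I,J)$-coset with $\#J=m$, then $\mathbb Sq(p)$ is a simple reflection of $\mathcal S_{n-m}$. For every fixed $J\subset S$ with $\#J=m$, the map $(I,p)\mapsto\mathbb Sq(p)$ is a bijection from the set of pairs $(I,p)$ with $p$ an atomic $(I,J)$-coset to the set of simple reflections of $\mathcal S_{n-m}$. 4. If $p$ is a core $(I,J)$-coset, $q$ a core $(J,K)$-coset, $\#J=m$, and $r=p.q$, then $r$ is a core $(I,K)$-coset and $\mathbb Sq(r)=\mathbb Sq(p).\mathbb Sq(q)$, that is, $\mathbb Sq(r)=\mathbb Sq(p)\mathbb Sq(q)$ and $\ell(\mathbb Sq(r))=\ell(\mathbb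 Sq(p))+\ell(\mathbb Sq(q))$. -/

import Mathlib

/-! Double cosets, core cosets, atomic cosets and their reduced expressions in a Coxeter group
`W` with set of simple reflections `S`, and squashing in the symmetric groups.
The first part is written for a group `W` with a set `S` of generators. It is applied only to
finite Coxeter groups, where every subset of `S` is finitary. -/

namespace CoreCoset

noncomputable section

section Coxeter

variable {W : Type*} [Group W]

/-- The Coxeter length: the least number of factors in an expression of `w` as a product of
simple reflections. -/
def len (S : Set W) (w : W) : ℕ :=
  sInf {k | ∃ l : List W, (∀ x ∈ l, x ∈ S) ∧ l.prod = w ∧ l.length = k}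

/-- `l` is an (ordinary) reduced expression of `w`. -/
def IsRex (S : Set W) (w : W) (l : List W) : Prop :=
  (∀ x ∈ l, x ∈ S) ∧ l.prod = w ∧ l.length = len S w

/-- The product `x y` is a reduced composition, `x y = x . y`. -/
def LenAdd (S : Set W) (x y : W) : Prop :=
  len S (x * y) = len S x + len S y

/-- The Bruhat order, generated by `x < x t` for reflections `t` (conjugates of simple
reflections) with `ℓ(x) < ℓ(x t)`. -/
def BruhatLE (S : Set W) : W → W → Prop :=
  Relation.ReflTransGen fun x y =>
    ∃ g : W, ∃ s ∈ S, y = x * (g * s * g⁻¹) ∧ len S x < len S y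

open Classical in
/-- The Bruhat-smallest element of `p` (with value `1` if there is none). -/
def minElt (S : Set W) (p : Set W) : W :=
  if h : ∃ x ∈ p, ∀ y ∈ p, BruhatLE S x y then h.choose else 1

open Classical in
/-- The Bruhat-largest element of `p` (with value `1` if there is none). -/
def maxElt (S : Set W) (p : Set W) : W :=
  if h : ∃ x ∈ p, ∀ y ∈ p, BruhatLE S y x then h.choose else 1

/-- The longest element `w_I` of the parabolic subgroup `W_I`. -/
def longest (S I : Set W) : W :=
  maxElt S (Subgroup.closure I : Set W)

/-- The double coset `W_I w W_J`. -/
def dcoset (I J : Set W) (w : W) : Set W :=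
  DoubleCoset.doubleCoset w (Subgroup.closure I : Set W) (Subgroup.closure J : Set W)

/-- `p` is an `(I,J)`-coset. -/
def IsDCoset (S I J : Set W) (p : Set W) : Prop :=
  I ⊆ S ∧ J ⊆ S ∧ ∃ w : W, p = dcoset I J w

/-- The left redundancy `I ∩ x J x⁻¹`, where `x` is the minimal element of `p`. -/
def leftRed (S I J : Set W) (p : Set W) : Set W :=
  I ∩ (fun j => minElt S p * j * (minElt S p)⁻¹) '' J

/-- The right redundancy `x⁻¹ I x ∩ J`, where `x` is the minimal element of `p`. -/
def rightRed (S I J : Set W) (p : Set W) : Set W :=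
  (fun i => (minElt S p)⁻¹ * i * minElt S p) '' I ∩ J

/-- `p` is a core `(I,J)`-coset. -/
def IsCore (S I J : Set W) (p : Set W) : Prop :=
  IsDCoset S I J p ∧ leftRed S I J p = I ∧ rightRed S I J p = J

open Classical in
/-- The product `x * y` in the Coxeter monoid, where `W` is identified with the Coxeter monoid
through reduced expressions: the letters of a reduced expression of `y` are multiplied to `x`
one after the other, and `x * s` is `x s` if this is longer than `x`, and `x` otherwise.
(The result does not depend on the reduced expression.) -/
def star (S : Set W) (x y : W) : W :=
  if h : ∃ l : List W, IsRex S y l then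
    h.choose.foldl (fun z s => if len S z < len S (z * s) then z * s else z) x
  else x * y

/-- For an `(I,J)`-coset `p` and a `(J,K)`-coset `q`, the composition `p * q` is reduced. -/
def IsReducedComp (S J : Set W) (p q : Set W) : Prop :=
  LenAdd S (maxElt S p * (longest S J)⁻¹) (maxElt S q) ∧
  LenAdd S (maxElt S p) ((longest S J)⁻¹ * maxElt S q) ∧
  star S (maxElt S p) (maxElt S q) = maxElt S p * (longest S J)⁻¹ * maxElt S q

/-- `r = p . q`, that is `r = p * q = W_I (p̄ * q̄) W_K` and this composition is reduced,
for an `(I,J)`-coset `p` and a `(J,K)`-coset `q`. -/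
def IsReducedProd (S I J K : Set W) (r p q : Set W) : Prop :=
  IsReducedComp S J p q ∧ r = dcoset I K (star S (maxElt S p) (maxElt S q))

/-- A multistep expression `[[I = I₀ ⊆ K₁ ⊇ I₁ ⊆ K₂ ⊇ … ⊆ K_d ⊇ I_d = J]]` is given by `I` and
the list `[(K₁, I₁), …, (K_d, I_d)]`. Concatenation of expressions is concatenation of lists. -/
def IsExpr (S : Set W) : Set W → Set W → List (Set W × Set W) → Prop
  | I, J, [] => I ⊆ S ∧ I = J
  | I, J, (K, I') :: l => I ⊆ K ∧ I' ⊆ K ∧ K ⊆ S ∧ IsExpr S I' J l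

/-- The element `w_{K₁} w_{I₁}⁻¹ w_{K₂} w_{I₂}⁻¹ ⋯ w_{K_d}` of a multistep expression
(`w_I` if `d = 0`). The recursion produces a last factor `w_{I_d}⁻¹ w_{I_d} = 1`. -/
def exprElt (S : Set W) : Set W → List (Set W × Set W) → W
  | I, [] => longest S I
  | _, (K, I') :: l => longest S K * (longest S I')⁻¹ * exprElt S I' l

/-- The integer `ℓ(K₁) - ℓ(I₁) + ℓ(K₂) - ⋯ + ℓ(K_d)` of a multistep expression
(`ℓ(I)` if `d = 0`). -/
def exprLen (S : Set W) : Set W → List (Set W × Set W) → ℤ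
  | I, [] => len S (longest S I)
  | _, (K, I') :: l =>
      (len S (longest S K) : ℤ) - len S (longest S I') + exprLen S I' l

/-- The multistep expression given by `I` and `l` is a reduced expression of the
`(I,J)`-coset `p`. -/
def IsReducedExpr (S I J : Set W) (p : Set W) (l : List (Set W × Set W)) : Prop :=
  IsDCoset S I J p ∧ IsExpr S I J l ∧
    maxElt S p = exprElt S I l ∧ (len S (maxElt S p) : ℤ) = exprLen S I l

/-- `p` is an atomic `(I,J)`-coset: a core coset with a reduced expression
`[I + s - t] = [I, I ∪ {s}, (I ∪ {s}) \ {t}]`. -/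
def IsAtomic (S I J : Set W) (p : Set W) : Prop :=
  IsCore S I J p ∧ ∃ s ∈ S, ∃ t ∈ S, s ∉ I ∧ t ∈ I ∪ {s} ∧ J = (I ∪ {s}) \ {t} ∧
    IsReducedExpr S I J p [(I ∪ {s}, J)]

/-- Every step `[[I_{i-1} ⊆ K_i ⊇ I_i]]` is a reduced expression of an atomic coset. -/
def AtomicSteps (S : Set W) : Set W → List (Set W × Set W) → Prop
  | _, [] => True
  | I, (K, I') :: l =>
      (∃ q, IsAtomic S I I' q ∧ IsReducedExpr S I I' q [(K, I')]) ∧ AtomicSteps S I' l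

/-- Atomic reduced expressions of the `(I,J)`-coset `p`: reduced expressions which are
compositions of reduced expressions of atomic cosets. -/
def IsAtomicRex (S I J : Set W) (p : Set W) (l : List (Set W × Set W)) : Prop :=
  IsReducedExpr S I J p l ∧ AtomicSteps S I l

end Coxeter

section TypeA

/-- The simple reflections of the symmetric group on `{0, …, n-1}`: the transpositions of
neighbours. -/
def simples (n : ℕ) : Set (Equiv.Perm (Fin n)) :=
  {w | ∃ i j : Fin n, (j : ℕ) = i + 1 ∧ w = Equiv.swap i j}

variable {n : ℕ}

/-- The equivalence class of `x` for the equivalence relation generated by `j ∼ j + 1` whenever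
the transposition of `j` and `j + 1` lies in `J`. -/
def component (J : Set (Equiv.Perm (Fin n))) (x : Fin n) : Set (Fin n) :=
  {z | Relation.EqvGen (fun i j : Fin n => (j : ℕ) = i + 1 ∧ Equiv.swap i j ∈ J) x z}

/-- The position (counted from `0`) of the component of `x` in the ordered set of components:
the number of components which lie to the left of it. -/
def compIndex (J : Set (Equiv.Perm (Fin n))) (x : Fin n) : ℕ :=
  Set.ncard {C : Set (Fin n) | (∃ z, C = component J z) ∧
    ∀ a ∈ C, ∀ b ∈ component J x, a < b}

/-- `y` maps each component for `J` by an order-preserving bijection onto a component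
for `I`. -/
def IsBlockPerm (I J : Set (Equiv.Perm (Fin n))) (y : Equiv.Perm (Fin n)) : Prop :=
  ∀ x : Fin n, y '' component J x = component I (y x) ∧ StrictMonoOn y (component J x)

/-- `w` is the permutation of the `n - m` positions of components which is induced by the
block permutation `y`. -/
def IsSquash (m : ℕ) (I J : Set (Equiv.Perm (Fin n))) (y : Equiv.Perm (Fin n))
    (w : Equiv.Perm (Fin (n - m))) : Prop :=
  ∀ x : Fin n, ∃ c : Fin (n - m), (c : ℕ) = compIndex J x ∧ (w c : ℕ) = compIndex I (y x)

open Classical in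
/-- The squashed permutation of a block permutation `y` relative to sets `I` and `J` of size `m`
(with value `1` if `y` does not induce a permutation). -/
def squash (m : ℕ) (I J : Set (Equiv.Perm (Fin n))) (y : Equiv.Perm (Fin n)) :
    Equiv.Perm (Fin (n - m)) :=
  if h : ∃ w, IsSquash m I J y w then h.choose else 1

/-- The squashed permutation `𝕊q(p)` of a core `(I,J)`-coset `p`, where `I` and `J` have
size `m`. -/
def Sq (m : ℕ) (I J : Set (Equiv.Perm (Fin n))) (p : Set (Equiv.Perm (Fin n))) :
    Equiv.Perm (Fin (n - m)) :=
  squash m I J (minElt (simples n) p)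

/-- The list `(𝕊q(p₁), …, 𝕊q(p_d))`, where `p_i` is the coset of `w_{K_i}` with the expression
`[[I_{i-1} ⊆ K_i ⊇ I_i]]`. -/
def sqExpr (m : ℕ) : Set (Equiv.Perm (Fin n)) →
    List (Set (Equiv.Perm (Fin n)) × Set (Equiv.Perm (Fin n))) →
    List (Equiv.Perm (Fin (n - m)))
  | _, [] => []
  | I, (K, I') :: l =>
      Sq m I I' (dcoset I I' (longest (simples n) K)) :: sqExpr m I' l

end TypeA

end

end CoreCoset

/-! The minimal elements of the core cosets are exactly the permutations `z` which carry the
components of `J` increasingly onto those of `I`. They form a groupoid; `z` is determined by its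
source (or by its target) and the permutation it induces on the components, and every permutation of
the components occurs. The inversions of `z` are the pairs of points in distinct components whose
order is reversed by the induced permutation, so lengths add in a product of such elements if and
only if they add after squashing.

The maximal element of the coset of `z` is `z w_J`, with `ℓ(z w_J) = ℓ(z) + ℓ(w_J)`. For a simple
reflection `t ∉ J` at the boundary of two neighbouring components, `z w_J` is the longest element of
the parabolic subgroup of `J ∪ {t}` if and only if `z` induces the transposition of these two
components. Hence the atomic cosets are the core cosets which squash to simple reflections, and
atomic reduced expressions correspond step by step to reduced expressions of the squashed
permutation. -/

namespace CoreCoset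

open Equiv (Perm swap)

section Group

variable {W : Type*} [Group W] {S I J p : Set W} {w x y z s : W}

theorem len_prod_le {l : List W} (hl : ∀ s ∈ l, s ∈ S) : len S l.prod ≤ l.length :=
  Nat.sInf_le ⟨l, hl, rfl, rfl⟩

theorem BruhatLE.len_le_and_eq_of_len_le (h : BruhatLE S x y) :
    len S x ≤ len S y ∧ (len S y ≤ len S x → x = y) := by
  induction h with
  | refl => exact ⟨le_rfl, fun _ => rfl⟩
  | tail _ h ih =>
    obtain ⟨_, _, _, _, hlt⟩ := h
    exact ⟨ih.1.trans hlt.le, fun h => absurd hlt (h.trans ih.1).not_gt⟩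

theorem BruhatLE.antisymm (h : BruhatLE S x y) (h' : BruhatLE S y x) : x = y :=
  h.len_le_and_eq_of_len_le.2 h'.len_le_and_eq_of_len_le.1

theorem minElt_eq_of_forall_bruhatLE (hx : x ∈ p) (h : ∀ y ∈ p, BruhatLE S x y) :
    minElt S p = x := by
  have hex : ∃ x ∈ p, ∀ y ∈ p, BruhatLE S x y := ⟨x, hx, h⟩
  rw [minElt, dif_pos hex]
  exact (hex.choose_spec.2 x hx).antisymm (h _ hex.choose_spec.1)

theorem maxElt_eq_of_forall_bruhatLE (hx : x ∈ p) (h : ∀ y ∈ p, BruhatLE S y x) :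
    maxElt S p = x := by
  have hex : ∃ x ∈ p, ∀ y ∈ p, BruhatLE S y x := ⟨x, hx, h⟩
  rw [maxElt, dif_pos hex]
  exact (h _ hex.choose_spec.1).antisymm (hex.choose_spec.2 x hx)

theorem bruhatLE_mul_right (hs : s ∈ S) (h : len S x < len S (x * s)) : BruhatLE S x (x * s) :=
  .single ⟨1, s, hs, by simp, h⟩

theorem bruhatLE_mul_left (hs : s ∈ S) (h : len S x < len S (s * x)) : BruhatLE S x (s * x) :=
  .single ⟨x⁻¹, s, hs, by group, h⟩

theorem self_mem_dcoset (I J : Set W) (w : W) : w ∈ dcoset I J w :=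
  DoubleCoset.mem_doubleCoset.2 ⟨1, Subgroup.one_mem _, 1, Subgroup.one_mem _, by group⟩

theorem mul_mem_dcoset_right (hy : y ∈ dcoset I J w) (hx : x ∈ Subgroup.closure J) :
    y * x ∈ dcoset I J w := by
  obtain ⟨a, ha, b, hb, rfl⟩ := DoubleCoset.mem_doubleCoset.1 hy
  exact DoubleCoset.mem_doubleCoset.2 ⟨a, ha, b * x, Subgroup.mul_mem _ hb hx, by group⟩

theorem mul_mem_dcoset_left (hy : y ∈ dcoset I J w) (hx : x ∈ Subgroup.closure I) :
    x * y ∈ dcoset I J w := by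
  obtain ⟨a, ha, b, hb, rfl⟩ := DoubleCoset.mem_doubleCoset.1 hy
  exact DoubleCoset.mem_doubleCoset.2 ⟨x * a, Subgroup.mul_mem _ hx ha, b, hb, by group⟩

theorem dcoset_eq_of_mem (h : y ∈ dcoset I J w) : dcoset I J y = dcoset I J w :=
  DoubleCoset.doubleCoset_eq_of_mem h

theorem dcoset_self_one (J : Set W) : dcoset J J 1 = (Subgroup.closure J : Set W) := by
  ext y
  refine ⟨fun hy => ?_, fun hy => ?_⟩
  · obtain ⟨a, ha, b, hb, rfl⟩ := DoubleCoset.mem_doubleCoset.1 hy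
    simpa using Subgroup.mul_mem _ ha hb
  · simpa using mul_mem_dcoset_right (self_mem_dcoset J J 1) hy

theorem exists_bruhatLE_forall_len_le_mul (hS : ∀ s ∈ S, s * s = 1) (hI : I ⊆ S) (hJ : J ⊆ S)
    (hy : y ∈ dcoset I J w) :
    ∃ z ∈ dcoset I J w, BruhatLE S z y ∧
      (∀ s ∈ I, len S z ≤ len S (s * z)) ∧ ∀ s ∈ J, len S z ≤ len S (z * s) := by
  obtain ⟨z, ⟨hz, hzy⟩, hmin⟩ := exists_minimalFor_of_wellFoundedLT
    (fun z => z ∈ dcoset I J w ∧ BruhatLE S z y) (len S) ⟨y, hy, .refl⟩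
  refine ⟨z, hz, hzy, fun s hs => ?_, fun s hs => ?_⟩ <;> by_contra! hlt
  · have hle : BruhatLE S (s * z) z := by
      simpa [← mul_assoc, hS s (hI hs)] using
        bruhatLE_mul_left (x := s * z) (hI hs) (by simpa [← mul_assoc, hS s (hI hs)] using hlt)
    exact hlt.not_ge
      (hmin ⟨mul_mem_dcoset_left hz (Subgroup.subset_closure hs), hle.trans hzy⟩ hlt.le)
  · have hle : BruhatLE S (z * s) z := by
      simpa [mul_assoc, hS s (hJ hs)] using
        bruhatLE_mul_right (x := z * s) (hJ hs) (by simpa [mul_assoc, hS s (hJ hs)] using hlt)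
    exact hlt.not_ge
      (hmin ⟨mul_mem_dcoset_right hz (Subgroup.subset_closure hs), hle.trans hzy⟩ hlt.le)

theorem exists_bruhatLE_forall_len_mul_le [Finite W] (hJ : J ⊆ S) (hy : y ∈ dcoset I J w) :
    ∃ z ∈ dcoset I J w, BruhatLE S y z ∧ ∀ s ∈ J, len S (z * s) ≤ len S z := by
  obtain ⟨z, ⟨hz, hyz⟩, hmax⟩ := Set.Finite.exists_maximalFor (len S)
    {z | z ∈ dcoset I J w ∧ BruhatLE S y z} (Set.toFinite _) ⟨y, hy, .refl⟩
  refine ⟨z, hz, hyz, fun s hs => ?_⟩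
  by_contra! hlt
  exact hlt.not_ge (hmax ⟨mul_mem_dcoset_right hz (Subgroup.subset_closure hs),
    hyz.trans (bruhatLE_mul_right (hJ hs) hlt)⟩ hlt.le)

end Group

section Disorders

variable {α : Type*} [LinearOrder α]

theorem swap_apply_lt_swap_apply {i j a b : α} (hij : i ⋖ j) (hab : a < b)
    (hne : ¬(a = i ∧ b = j)) : swap i j a < swap i j b := by
  have hle : ∀ c, i < c → j ≤ c := fun c hc => not_lt.1 (hij.2 hc)
  have hge : ∀ c, c < j → c ≤ i := fun c hc => not_lt.1 fun h => hij.2 h hc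
  rw [Equiv.swap_apply_def, Equiv.swap_apply_def]
  grind [hij.lt]

theorem exists_covBy_and_apply_lt [Finite α] {w : Perm α} (hw : w ≠ 1) :
    ∃ i j, i ⋖ j ∧ w j < w i := by
  classical
  let := Fintype.ofFinite α
  let := Fintype.toLocallyFiniteOrder (α := α)
  by_contra! h
  have hmono : StrictMono w := (strictMono_iff_forall_covBy _).2 fun i j hij =>
    (h i j hij).lt_of_ne (by simpa using hij.lt.ne)
  exact hw (Equiv.ext fun x => congrFun hmono.eq_id x)

variable [Fintype α]

/-- The pairs of points whose order is changed by `w`. Every inversion is counted twice, as `(i, j)`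
and as `(j, i)`; in return composition of permutations becomes a symmetric difference. -/
def disorders (w : Perm α) : Finset (α × α) :=
  {a | ¬(a.1 < a.2 ↔ w a.1 < w a.2)}

theorem mem_disorders {w : Perm α} {a : α × α} :
    a ∈ disorders w ↔ ¬(a.1 < a.2 ↔ w a.1 < w a.2) := by
  simp [disorders]

theorem disorders_one : disorders (1 : Perm α) = ∅ := by
  simp [disorders]

/-- The pairs of points whose order is changed by `y` and changed back by `x`. -/
def conflicts (x y : Perm α) : Finset (α × α) :=
  {a ∈ disorders y | (a.1 < a.2 ↔ x (y a.1) < x (y a.2))}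

theorem card_disorders_add_card_disorders (x y : Perm α) :
    (disorders x).card + (disorders y).card =
      (disorders (x * y)).card + 2 * (conflicts x y).card := by
  have hx : (disorders x).card =
      ({a | ¬(y a.1 < y a.2 ↔ x (y a.1) < x (y a.2))} : Finset (α × α)).card := by
    refine (Finset.card_equiv (y.prodCongr y) fun a => ?_).symm
    simp [disorders]
  rw [hx]
  simp only [disorders, conflicts, Finset.filter_filter, Finset.card_filter, Finset.mul_sum,
    ← Finset.sum_add_distrib]
  refine Finset.sum_congr rfl fun a _ => ?_
  by_cases h₁ : a.1 < a.2 <;> by_cases h₂ : y a.1 < y a.2 <;>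
    by_cases h₃ : x (y a.1) < x (y a.2) <;> simp [h₁, h₂, h₃]

theorem conflicts_eq_empty_iff {x y : Perm α} :
    conflicts x y = ∅ ↔ ∀ i j, i < j → y j < y i → x (y j) < x (y i) := by
  simp only [conflicts, Finset.filter_eq_empty_iff, mem_disorders, Prod.forall]
  refine ⟨fun h i j hij hy => ?_, fun h i j hij hc => ?_⟩
  · have := h i j (by simp [hij, hy.le])
    exact (not_lt.1 (by simpa [hij] using this)).lt_of_ne (by simpa using hij.ne')
  · rcases lt_trichotomy i j with hlt | rfl | hlt
    · have hy : y j < y i := (not_lt.1 (by simpa [hlt] using hij)).lt_of_ne (by simpa using hlt.ne')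
      exact lt_asymm (h i j hlt hy) (hc.1 hlt)
    · simp at hij
    · have hy : y i < y j := by simpa [hlt.not_gt] using hij
      exact hlt.not_gt (hc.2 (h j i hlt hy))

theorem disorders_swap {i j : α} (hij : i ⋖ j) : disorders (swap i j) = {(i, j), (j, i)} := by
  ext ⟨a, b⟩
  simp only [mem_disorders, Finset.mem_insert, Finset.mem_singleton, Prod.mk.injEq]
  refine ⟨fun h => ?_, ?_⟩
  · by_contra! hne
    rcases lt_trichotomy a b with hab | rfl | hab
    · exact h (by simp [hab, swap_apply_lt_swap_apply hij hab (by tauto)])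
    · simp at h
    · exact h (by simp [hab.not_gt, (swap_apply_lt_swap_apply hij hab (by tauto)).le])
  · rintro (⟨rfl, rfl⟩ | ⟨rfl, rfl⟩) <;> simp [hij.lt, hij.lt.le]

theorem card_disorders_swap {i j : α} (hij : i ⋖ j) : (disorders (swap i j)).card = 2 := by
  rw [disorders_swap hij, Finset.card_pair]
  simp [hij.lt.ne]

theorem card_disorders_mul_swap_of_lt {i j : α} (hij : i ⋖ j) {w : Perm α} (h : w i < w j) :
    (disorders (w * swap i j)).card = (disorders w).card + 2 := by
  have hconf : conflicts w (swap i j) = ∅ := by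
    refine conflicts_eq_empty_iff.2 fun a b hab hs => ?_
    by_cases hne : a = i ∧ b = j
    · obtain ⟨rfl, rfl⟩ := hne
      simpa using h
    · exact absurd (swap_apply_lt_swap_apply hij hab hne) hs.not_gt
  have hadd := card_disorders_add_card_disorders w (swap i j)
  rw [card_disorders_swap hij, hconf, Finset.card_empty] at hadd
  omega

theorem card_disorders_mul_swap_of_gt {i j : α} (hij : i ⋖ j) {w : Perm α} (h : w j < w i) :
    (disorders (w * swap i j)).card + 2 = (disorders w).card := by
  rw [← card_disorders_mul_swap_of_lt hij (by simpa using h), Equiv.mul_swap_mul_self]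

theorem card_disorders_inv (w : Perm α) : (disorders w⁻¹).card = (disorders w).card :=
  (Finset.card_equiv (w.prodCongr w) fun a => by simp [disorders, iff_comm]).symm

end Disorders

section Length

variable {n : ℕ}

theorem covBy_iff_val_eq {i j : Fin n} : i ⋖ j ↔ (j : ℕ) = i + 1 := by
  rw [Fin.covBy_iff, Nat.covBy_iff_add_one_eq, eq_comm]

theorem mem_simples_iff {w : Perm (Fin n)} :
    w ∈ simples n ↔ ∃ i j : Fin n, i ⋖ j ∧ w = swap i j := by
  simp only [simples, covBy_iff_val_eq, Set.mem_ofPred_eq]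

theorem swap_mem_simples {i j : Fin n} (hij : i ⋖ j) : swap i j ∈ simples n :=
  mem_simples_iff.2 ⟨i, j, hij, rfl⟩

theorem mul_self_of_mem_simples {s : Perm (Fin n)} (hs : s ∈ simples n) : s * s = 1 := by
  obtain ⟨i, j, -, rfl⟩ := hs
  exact Equiv.swap_mul_self i j

theorem card_disorders_of_mem_simples {s : Perm (Fin n)} (hs : s ∈ simples n) :
    (disorders s).card = 2 := by
  obtain ⟨i, j, hij, rfl⟩ := mem_simples_iff.1 hs
  exact card_disorders_swap hij

theorem card_disorders_prod_le {l : List (Perm (Fin n))} (hl : ∀ s ∈ l, s ∈ simples n) :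
    (disorders l.prod).card ≤ 2 * l.length := by
  induction l with
  | nil => simp [disorders_one]
  | cons s l ih =>
    have hadd := card_disorders_add_card_disorders s l.prod
    have hle := ih fun x hx => hl x (List.mem_cons_of_mem s hx)
    rw [card_disorders_of_mem_simples (hl s List.mem_cons_self)] at hadd
    simp only [List.prod_cons, List.length_cons]
    omega

theorem exists_list_simples_prod_eq (w : Perm (Fin n)) :
    ∃ l : List (Perm (Fin n)), (∀ s ∈ l, s ∈ simples n) ∧ l.prod = w ∧
      2 * l.length = (disorders w).card := by
  induction hk : (disorders w).card using Nat.strong_induction_on generalizing w with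
  | _ k ih =>
    by_cases hw : w = 1
    · exact ⟨[], by simp, by simp [hw], by simp [← hk, hw, disorders_one]⟩
    · obtain ⟨i, j, hij, hdesc⟩ := exists_covBy_and_apply_lt hw
      have hcard := card_disorders_mul_swap_of_gt hij hdesc
      obtain ⟨l, hl, hprod, hlen⟩ := ih _ (by omega) (w * swap i j) rfl
      refine ⟨l ++ [swap i j], ?_, by simp [hprod], ?_⟩
      · simpa [or_imp, forall_and] using ⟨hl, swap_mem_simples hij⟩
      · simp only [List.length_append, List.length_singleton]
        omega

theorem two_mul_len (w : Perm (Fin n)) : 2 * len (simples n) w = (disorders w).card := by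
  obtain ⟨l, hl, hprod, hlen⟩ := exists_list_simples_prod_eq w
  obtain ⟨l', hl', hprod', hlen'⟩ := Nat.sInf_mem
    (s := {k | ∃ l : List (Perm (Fin n)), (∀ s ∈ l, s ∈ simples n) ∧ l.prod = w ∧ l.length = k})
    ⟨_, l, hl, hprod, rfl⟩
  change l'.length = len (simples n) w at hlen'
  refine le_antisymm ?_ ?_
  · rw [← hlen, ← hprod]
    exact Nat.mul_le_mul_left 2 (len_prod_le hl)
  · rw [← hlen', ← hprod']
    exact card_disorders_prod_le hl'

theorem len_one : len (simples n) 1 = 0 := by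
  simpa [disorders_one] using two_mul_len (1 : Perm (Fin n))

theorem len_inv (w : Perm (Fin n)) : len (simples n) w⁻¹ = len (simples n) w := by
  have := two_mul_len w
  have := two_mul_len w⁻¹
  rw [card_disorders_inv] at this
  omega

theorem len_mul_le (x y : Perm (Fin n)) :
    len (simples n) (x * y) ≤ len (simples n) x + len (simples n) y := by
  have := card_disorders_add_card_disorders x y
  simp only [← two_mul_len] at this
  omega

theorem len_of_mem_simples {s : Perm (Fin n)} (hs : s ∈ simples n) : len (simples n) s = 1 := by
  have := two_mul_len s
  rw [card_disorders_of_mem_simples hs] at this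
  omega

theorem lenAdd_iff {x y : Perm (Fin n)} :
    LenAdd (simples n) x y ↔ ∀ i j, i < j → y j < y i → x (y j) < x (y i) := by
  have := card_disorders_add_card_disorders x y
  simp only [← two_mul_len] at this
  rw [← conflicts_eq_empty_iff, ← Finset.card_eq_zero, LenAdd]
  omega

theorem len_lt_len_mul_swap {i j : Fin n} (hij : i ⋖ j) {w : Perm (Fin n)} (h : w i < w j) :
    len (simples n) w < len (simples n) (w * swap i j) := by
  have := card_disorders_mul_swap_of_lt hij h
  simp only [← two_mul_len] at this
  omega

theorem apply_lt_apply_of_len_le_mul_swap {i j : Fin n} (hij : i ⋖ j) {w : Perm (Fin n)}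
    (h : len (simples n) w ≤ len (simples n) (w * swap i j)) : w i < w j := by
  by_contra! hle
  have hlt : w j < w i := hle.lt_of_ne (by simpa using hij.lt.ne')
  exact h.not_gt (by simpa using len_lt_len_mul_swap hij (w := w * swap i j) (by simpa using hlt))

theorem apply_lt_apply_of_len_mul_swap_le {i j : Fin n} (hij : i ⋖ j) {w : Perm (Fin n)}
    (h : len (simples n) (w * swap i j) ≤ len (simples n) w) : w j < w i := by
  by_contra! hle
  exact h.not_gt (len_lt_len_mul_swap hij (hle.lt_of_ne (by simpa using hij.lt.ne)))

theorem inv_apply_lt_inv_apply_of_len_le_swap_mul {i j : Fin n} (hij : i ⋖ j) {w : Perm (Fin n)}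
    (h : len (simples n) w ≤ len (simples n) (swap i j * w)) : w⁻¹ i < w⁻¹ j := by
  refine apply_lt_apply_of_len_le_mul_swap hij ?_
  rwa [← len_inv (w⁻¹ * _), mul_inv_rev, inv_inv, Equiv.swap_inv, len_inv]

end Length

section Blocks

variable {n : ℕ} {I J : Set (Perm (Fin n))}

theorem covBy_induction {P : Fin n → Prop} (isMin : ∀ x, IsMin x → P x)
    (covBy : ∀ i j, i ⋖ j → P i → P j) (x : Fin n) : P x := by
  induction x using WellFoundedLT.induction with
  | _ x ih =>
    by_cases hx : IsMin x
    · exact isMin x hx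
    · have hpred := Order.pred_covBy_of_not_isMin hx
      exact covBy _ _ hpred (ih _ hpred.lt)

theorem swap_inj_of_lt {α : Type*} [LinearOrder α] {i j i' j' : α} (hij : i < j) (hij' : i' < j')
    (h : swap i j = swap i' j') : i = i' ∧ j = j' := by
  have hi : swap i' j' i = j := by rw [← h, Equiv.swap_apply_left]
  rw [Equiv.swap_apply_def] at hi
  grind

/-- The right ends of the components of `J`. The last point is always one of them: there
`Order.succ i = i`, so that the transposition is `1`, which is not simple. -/
def blockEnds (J : Set (Perm (Fin n))) : Set (Fin n) :=
  {i | swap i (Order.succ i) ∉ J}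

theorem mem_blockEnds_iff {i j : Fin n} (hij : i ⋖ j) : i ∈ blockEnds J ↔ swap i j ∉ J := by
  simp [blockEnds, hij.succ_eq]

/-- The number of components of `J` to the left of `x`. -/
noncomputable def blockIndex (J : Set (Perm (Fin n))) (x : Fin n) : ℕ :=
  (blockEnds J ∩ Set.Iio x).ncard

theorem blockIndex_mono (J : Set (Perm (Fin n))) : Monotone (blockIndex J) := fun _ _ hxy =>
  Set.ncard_le_ncard (Set.inter_subset_inter_right _ (Set.Iio_subset_Iio hxy))

theorem lt_of_blockIndex_lt {x y : Fin n} (h : blockIndex J x < blockIndex J y) : x < y :=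
  (blockIndex_mono J).reflect_lt h

theorem blockIndex_of_isMin {x : Fin n} (hx : IsMin x) : blockIndex J x = 0 := by
  simp [blockIndex, hx.Iio_eq]

theorem blockIndex_eq_of_swap_mem {i j : Fin n} (hij : i ⋖ j) (h : swap i j ∈ J) :
    blockIndex J i = blockIndex J j := by
  rw [blockIndex, blockIndex, hij.Iio_eq, ← Set.Iio_insert, Set.inter_insert_of_notMem]
  simpa [mem_blockEnds_iff hij] using h

theorem blockIndex_eq_add_one_of_swap_notMem {i j : Fin n} (hij : i ⋖ j) (h : swap i j ∉ J) :
    blockIndex J j = blockIndex J i + 1 := by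
  rw [blockIndex, blockIndex, hij.Iio_eq, ← Set.Iio_insert,
    Set.inter_insert_of_mem ((mem_blockEnds_iff hij).2 h), Set.ncard_insert_of_notMem (by simp)]

theorem swap_mem_iff_blockIndex_eq {i j : Fin n} (hij : i ⋖ j) :
    swap i j ∈ J ↔ blockIndex J i = blockIndex J j := by
  refine ⟨blockIndex_eq_of_swap_mem hij, fun h => ?_⟩
  by_contra hmem
  have := blockIndex_eq_add_one_of_swap_notMem hij hmem
  omega

theorem eq_blockIndex {f : Fin n → ℕ} (isMin : ∀ x, IsMin x → f x = 0)
    (mem : ∀ i j, i ⋖ j → swap i j ∈ J → f i = f j)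
    (notMem : ∀ i j, i ⋖ j → swap i j ∉ J → f j = f i + 1) : f = blockIndex J := by
  ext x
  induction x using covBy_induction with
  | isMin x hx => rw [isMin x hx, blockIndex_of_isMin hx]
  | covBy i j hij ih =>
    by_cases h : swap i j ∈ J
    · rw [← mem i j hij h, ih, blockIndex_eq_of_swap_mem hij h]
    · rw [notMem i j hij h, ih, blockIndex_eq_add_one_of_swap_notMem hij h]

theorem rel_of_blockIndex_eq {R : Fin n → Fin n → Prop} (trans : ∀ x y z, R x y → R y z → R x z)
    (covBy : ∀ i j, i ⋖ j → swap i j ∈ J → R i j) {x y : Fin n} (hxy : x < y)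
    (h : blockIndex J x = blockIndex J y) : R x y := by
  suffices x < y ∧ (blockIndex J x = blockIndex J y → R x y) from this.2 h
  induction lt_iff_transGen_covBy.1 hxy using Relation.TransGen.trans_induction_on with
  | single hij => exact ⟨hij.lt, fun h => covBy _ _ hij ((swap_mem_iff_blockIndex_eq hij).2 h)⟩
  | trans hab hbc ihab ihbc =>
    have hab := lt_iff_transGen_covBy.2 hab
    have hbc := lt_iff_transGen_covBy.2 hbc
    refine ⟨hab.trans hbc, fun _ => ?_⟩
    have := blockIndex_mono J hab.le
    have := blockIndex_mono J hbc.le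
    exact trans _ _ _ ((ihab hab (by omega)).2 (by omega)) ((ihbc hbc (by omega)).2 (by omega))

theorem apply_eq_of_blockIndex_eq {α : Type*} {f : Fin n → α}
    (covBy : ∀ i j, i ⋖ j → swap i j ∈ J → f i = f j) {x y : Fin n}
    (h : blockIndex J x = blockIndex J y) : f x = f y := by
  have hlt : ∀ x y, x < y → blockIndex J x = blockIndex J y → f x = f y := fun x y =>
    rel_of_blockIndex_eq (R := fun x y => f x = f y) (fun _ _ _ => Eq.trans) covBy
  rcases lt_trichotomy x y with hxy | rfl | hxy
  exacts [hlt x y hxy h, rfl, (hlt y x hxy h.symm).symm]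

theorem subset_iff_blockIndex_eq (hI : I ⊆ simples n) :
    I ⊆ J ↔ ∀ x y, blockIndex I x = blockIndex I y → blockIndex J x = blockIndex J y := by
  refine ⟨fun h x y => apply_eq_of_blockIndex_eq fun i j hij hmem =>
    blockIndex_eq_of_swap_mem hij (h hmem), fun h s hs => ?_⟩
  obtain ⟨i, j, hij, rfl⟩ := mem_simples_iff.1 (hI hs)
  exact (swap_mem_iff_blockIndex_eq hij).2 (h i j (blockIndex_eq_of_swap_mem hij hs))

theorem eq_of_blockIndex_eq (hI : I ⊆ simples n) (hJ : J ⊆ simples n)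
    (h : blockIndex I = blockIndex J) : I = J :=
  ((subset_iff_blockIndex_eq hI).2 (by simp [h])).antisymm
    ((subset_iff_blockIndex_eq hJ).2 (by simp [h]))

theorem exists_blockIndex_jump {c : ℕ} {x : Fin n} (h : c < blockIndex J x) :
    ∃ i j, i ⋖ j ∧ blockIndex J i = c ∧ blockIndex J j = c + 1 := by
  induction x using covBy_induction with
  | isMin x hx => simp [blockIndex_of_isMin hx] at h
  | covBy i j hij ih =>
    by_cases hi : c < blockIndex J i
    · exact ih hi
    by_cases hmem : swap i j ∈ J
    · exact absurd (blockIndex_eq_of_swap_mem hij hmem ▸ h) hi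
    · have := blockIndex_eq_add_one_of_swap_notMem hij hmem
      exact ⟨i, j, hij, by omega, by omega⟩

theorem exists_blockIndex_eq {c : ℕ} {x : Fin n} (h : c ≤ blockIndex J x) :
    ∃ z, blockIndex J z = c := by
  rcases h.lt_or_eq with h | rfl
  · obtain ⟨i, _, _, hi, _⟩ := exists_blockIndex_jump h
    exact ⟨i, hi⟩
  · exact ⟨x, rfl⟩

theorem covBy_succ_of_notMem_blockEnds (hJ : J ⊆ simples n) {i : Fin n} (hi : i ∉ blockEnds J) :
    i ⋖ Order.succ i := by
  refine Order.covBy_succ_of_not_isMax fun hmax => ?_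
  obtain ⟨a, b, hab, hswap⟩ := mem_simples_iff.1 (hJ (not_not.1 hi))
  rw [hmax.succ_eq, Equiv.swap_self] at hswap
  exact hab.lt.ne (Equiv.swap_eq_refl_iff.1 hswap.symm)

theorem ncard_add_ncard_blockEnds (hJ : J ⊆ simples n) : J.ncard + (blockEnds J).ncard = n := by
  have himage : (fun i => swap i (Order.succ i)) '' (blockEnds J)ᶜ = J := by
    refine Set.Subset.antisymm (Set.image_subset_iff.2 fun i hi => not_not.1 hi) fun s hs => ?_
    obtain ⟨i, j, hij, rfl⟩ := mem_simples_iff.1 (hJ hs)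
    exact ⟨i, fun h => (mem_blockEnds_iff hij).1 h hs, congrArg (swap i) hij.succ_eq⟩
  have hinj : Set.InjOn (fun i => swap i (Order.succ i)) (blockEnds J)ᶜ := fun i hi j hj h =>
    (swap_inj_of_lt (covBy_succ_of_notMem_blockEnds hJ hi).lt
      (covBy_succ_of_notMem_blockEnds hJ hj).lt h).1
  have hcard : J.ncard = (blockEnds J)ᶜ.ncard := by rw [← hinj.ncard_image, himage]
  rw [hcard, add_comm, Set.ncard_add_ncard_compl, Nat.card_fin]

theorem blockIndex_add_one_of_isMax (hJ : J ⊆ simples n) {x : Fin n} (hx : IsMax x) :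
    blockIndex J x + 1 = n - J.ncard := by
  have hmem : x ∈ blockEnds J := by
    by_contra h
    exact (covBy_succ_of_notMem_blockEnds hJ h).lt.not_isMax hx
  have hends : insert x (blockEnds J ∩ Set.Iio x) = blockEnds J := by
    rw [← Set.inter_insert_of_mem hmem, Set.Iio_insert, hx.isTop.Iic_eq, Set.inter_univ]
  have hcard := ncard_add_ncard_blockEnds hJ
  rw [← hends, Set.ncard_insert_of_notMem (by simp)] at hcard
  rw [blockIndex]
  omega

theorem mem_range_blockIndex_iff (hJ : J ⊆ simples n) {c : ℕ} :
    c ∈ Set.range (blockIndex J) ↔ c < n - J.ncard := by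
  cases n with
  | zero => simp
  | succ n =>
    rw [← blockIndex_add_one_of_isMax hJ (fun y _ => Fin.le_last y : IsMax (Fin.last n)),
      Nat.lt_succ_iff]
    refine ⟨?_, exists_blockIndex_eq⟩
    rintro ⟨x, rfl⟩
    exact blockIndex_mono J (Fin.le_last x)

theorem exists_subset_simples_blockIndex_eq {f : Fin n → ℕ} (hf : Monotone f)
    (hrange : ∀ x, ∀ c ≤ f x, c ∈ Set.range f) : ∃ I ⊆ simples n, blockIndex I = f := by
  refine ⟨{w | ∃ i j, i ⋖ j ∧ w = swap i j ∧ f i = f j}, ?_, (eq_blockIndex ?_ ?_ ?_).symm⟩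
  · rintro w ⟨i, j, hij, rfl, -⟩
    exact swap_mem_simples hij
  · intro x hx
    obtain ⟨z, hz⟩ := hrange x 0 (Nat.zero_le _)
    have := hf ((le_total x z).elim id fun h => hx h)
    omega
  · rintro i j hij ⟨a, b, hab, hswap, heq⟩
    obtain ⟨rfl, rfl⟩ := swap_inj_of_lt hij.lt hab.lt hswap
    exact heq
  · intro i j hij hmem
    have hlt : f i < f j := (hf hij.le).lt_of_ne fun h => hmem ⟨i, j, hij, rfl, h⟩
    obtain ⟨z, hz⟩ := hrange j (f i + 1) hlt
    have := fun h : z ≤ i => hf h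
    have := fun h : j ≤ z => hf h
    have := hij.2 (c := z)
    grind

theorem component_eq (J : Set (Perm (Fin n))) (x : Fin n) :
    component J x = {z | blockIndex J z = blockIndex J x} := by
  have hlt : ∀ x y, x < y → blockIndex J x = blockIndex J y → y ∈ component J x := fun x y =>
    rel_of_blockIndex_eq (R := fun x y => y ∈ component J x)
      (fun _ _ _ hxy hyz => Relation.EqvGen.trans _ _ _ hxy hyz)
      fun i j hij hmem => .rel _ _ ⟨covBy_iff_val_eq.1 hij, hmem⟩
  ext z
  refine ⟨fun h => ?_, fun h => ?_⟩
  · induction h with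
    | rel i j h => exact (blockIndex_eq_of_swap_mem (covBy_iff_val_eq.2 h.1) h.2).symm
    | refl => rfl
    | symm _ _ _ ih => exact ih.symm
    | trans _ _ _ _ _ ih₁ ih₂ => exact ih₂.trans ih₁
  · rcases lt_trichotomy x z with hxz | rfl | hxz
    exacts [hlt x z hxz h.symm, .refl _, .symm _ _ (hlt z x hxz h)]

theorem compIndex_eq (J : Set (Perm (Fin n))) (x : Fin n) : compIndex J x = blockIndex J x := by
  have hset : {C : Set (Fin n) | (∃ z, C = component J z) ∧
      ∀ a ∈ C, ∀ b ∈ component J x, a < b} =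
      (fun c => {z | blockIndex J z = c}) '' Set.Iio (blockIndex J x) := by
    ext C
    simp only [component_eq, Set.mem_ofPred_eq, Set.mem_image, Set.mem_Iio]
    constructor
    · rintro ⟨⟨z, rfl⟩, h⟩
      have hzx : z < x := h z rfl x rfl
      exact ⟨blockIndex J z, (blockIndex_mono J hzx.le).lt_of_ne
        fun heq => lt_irrefl x (h x heq.symm x rfl), rfl⟩
    · rintro ⟨c, hc, rfl⟩
      obtain ⟨z, rfl⟩ := exists_blockIndex_eq hc.le
      exact ⟨⟨z, rfl⟩, fun a ha b hb =>
        lt_of_blockIndex_lt (ha.trans_lt (hc.trans_eq (Eq.symm hb)))⟩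
  have hinj : Set.InjOn (fun c => {z | blockIndex J z = c}) (Set.Iio (blockIndex J x)) := by
    intro c hc d _ h
    obtain ⟨z, rfl⟩ := exists_blockIndex_eq (Set.mem_Iio.1 hc).le
    exact (Set.ext_iff.1 h z).1 rfl
  rw [compIndex, hset, hinj.ncard_image, ← Finset.coe_Iio, Set.ncard_coe_finset, Nat.card_Iio]

theorem blockIndex_swap_apply {i j : Fin n} (hij : i ⋖ j) (h : swap i j ∈ J) (x : Fin n) :
    blockIndex J (swap i j x) = blockIndex J x := by
  have := blockIndex_eq_of_swap_mem hij h
  rw [Equiv.swap_apply_def]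
  split_ifs with hi hj
  exacts [hi ▸ this.symm, hj ▸ this, rfl]

theorem blockIndex_apply_of_mem_closure (hJ : J ⊆ simples n) {y : Perm (Fin n)}
    (hy : y ∈ Subgroup.closure J) (x : Fin n) : blockIndex J (y x) = blockIndex J x := by
  induction hy using Subgroup.closure_induction generalizing x with
  | mem s hs =>
    obtain ⟨i, j, hij, rfl⟩ := mem_simples_iff.1 (hJ hs)
    exact blockIndex_swap_apply hij hs x
  | one => simp
  | mul y z _ _ ihy ihz => simp [ihy, ihz]
  | inv y _ ih => simpa using (ih (y⁻¹ x)).symm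

theorem mem_closure_iff (hJ : J ⊆ simples n) {y : Perm (Fin n)} :
    y ∈ Subgroup.closure J ↔ ∀ x, blockIndex J (y x) = blockIndex J x := by
  refine ⟨blockIndex_apply_of_mem_closure hJ, fun hy => ?_⟩
  obtain ⟨z, hz, -, -, hmin⟩ := exists_bruhatLE_forall_len_le_mul (I := J) (J := J)
    (fun _ => mul_self_of_mem_simples) hJ hJ (self_mem_dcoset J J y)
  have hzJ : ∀ x, blockIndex J (z x) = blockIndex J x := by
    obtain ⟨a, ha, b, hb, rfl⟩ := DoubleCoset.mem_doubleCoset.1 hz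
    simp [blockIndex_apply_of_mem_closure hJ ha, blockIndex_apply_of_mem_closure hJ hb, hy]
  have hz1 : z = 1 := by
    by_contra hne
    obtain ⟨i, j, hij, hlt⟩ := exists_covBy_and_apply_lt hne
    by_cases hmem : swap i j ∈ J
    · exact hlt.asymm (apply_lt_apply_of_len_le_mul_swap hij (hmin _ hmem))
    · have hle := blockIndex_mono J hlt.le
      rw [hzJ, hzJ, blockIndex_eq_add_one_of_swap_notMem hij hmem] at hle
      omega
  rw [← SetLike.mem_coe, ← dcoset_self_one, ← hz1, dcoset_eq_of_mem hz]
  exact self_mem_dcoset J J y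

end Blocks

section Extremal

variable {n : ℕ} {α : Type*} {I J K : Set (Perm (Fin n))} {w y z : Perm (Fin n)}

/-- `f` is increasing on each component of `J`. -/
def StrictMonoOnBlocks [Preorder α] (J : Set (Perm (Fin n))) (f : Fin n → α) : Prop :=
  ∀ ⦃x y⦄, x < y → blockIndex J x = blockIndex J y → f x < f y

/-- `f` is decreasing on each component of `J`. -/
def StrictAntiOnBlocks [Preorder α] (J : Set (Perm (Fin n))) (f : Fin n → α) : Prop :=
  ∀ ⦃x y⦄, x < y → blockIndex J x = blockIndex J y → f y < f x

theorem StrictMonoOnBlocks.of_covBy [Preorder α] {f : Fin n → α}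
    (h : ∀ i j, i ⋖ j → swap i j ∈ J → f i < f j) : StrictMonoOnBlocks J f :=
  fun _ _ => rel_of_blockIndex_eq (R := fun x y => f x < f y) (fun _ _ _ => lt_trans) h

theorem StrictAntiOnBlocks.of_covBy [Preorder α] {f : Fin n → α}
    (h : ∀ i j, i ⋖ j → swap i j ∈ J → f j < f i) : StrictAntiOnBlocks J f :=
  StrictMonoOnBlocks.of_covBy (α := αᵒᵈ) h

theorem StrictMonoOnBlocks.lt_iff_lt [Preorder α] {f : Fin n → α} (hf : StrictMonoOnBlocks J f)
    {x y : Fin n} (h : blockIndex J x = blockIndex J y) : f x < f y ↔ x < y := by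
  refine ⟨fun hlt => ?_, fun hlt => hf hlt h⟩
  rcases lt_trichotomy x y with hxy | rfl | hxy
  exacts [hxy, absurd hlt (lt_irrefl _), absurd hlt (hf hxy h.symm).asymm]

theorem StrictMonoOnBlocks.monotone_toLex {β : Type*} [PartialOrder α] [Preorder β]
    {f : Fin n → α} {g : α → β} (hf : StrictMonoOnBlocks J f) (hg : Monotone g) :
    Monotone fun x => toLex (blockIndex J x, g (f x)) := by
  intro x y hxy
  rw [Prod.Lex.toLex_le_toLex]
  rcases hxy.lt_or_eq with hlt | rfl
  · exact (blockIndex_mono J hxy).lt_or_eq.imp_right fun h => ⟨h, hg (hf hlt h).le⟩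
  · exact .inr ⟨rfl, le_rfl⟩

theorem comp_eq_self_of_monotone_toLex [PartialOrder α] {f : Fin n → α}
    (hy : ∀ x, blockIndex J (y x) = blockIndex J x)
    (hf : Monotone fun x => toLex (blockIndex J x, f x))
    (hfy : Monotone fun x => toLex (blockIndex J x, f (y x))) : f ∘ y = f := by
  have h := Tuple.unique_monotone (f := fun x => toLex (blockIndex J x, f x)) (σ := y) (τ := 1)
    (by simpa [Function.comp_def, hy] using hfy) hf
  funext x
  exact congrArg (fun a => (ofLex a).2) (congrFun h x)

theorem eq_one_of_strictAntiOnBlocks (hy : ∀ x, blockIndex J (y x) = blockIndex J x)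
    (hz : StrictAntiOnBlocks J z) (hzy : StrictAntiOnBlocks J (z * y)) : y = 1 := by
  have hmono : ∀ {v : Perm (Fin n)}, StrictAntiOnBlocks J v →
      Monotone fun x => toLex (blockIndex J x, OrderDual.toDual (v x)) := fun hv =>
    StrictMonoOnBlocks.monotone_toLex (α := (Fin n)ᵒᵈ) hv monotone_id
  have h := comp_eq_self_of_monotone_toLex hy (hmono hz) (hmono hzy)
  exact Equiv.ext fun x => z.injective (congrFun h x)

theorem eq_of_strictMonoOnBlocks (hI : I ⊆ simples n) (hJ : J ⊆ simples n)
    (hmem : y ∈ dcoset I J z) (hz : StrictMonoOnBlocks J z) (hz' : StrictMonoOnBlocks I ⇑z⁻¹)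
    (hy : StrictMonoOnBlocks J y) (hy' : StrictMonoOnBlocks I ⇑y⁻¹) : y = z := by
  have hblock : ∀ x, blockIndex I (y x) = blockIndex I (z x) := by
    obtain ⟨u, hu, v, hv, rfl⟩ := DoubleCoset.mem_doubleCoset.1 hmem
    have huzv : ∀ x, blockIndex I ((u * z * v) x) = blockIndex I (z (v x)) := fun x =>
      blockIndex_apply_of_mem_closure hI hu _
    have hmono := hy.monotone_toLex (blockIndex_mono I)
    simp only [huzv] at hmono ⊢
    exact congrFun <| comp_eq_self_of_monotone_toLex (f := fun x => blockIndex I (z x))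
      (blockIndex_apply_of_mem_closure hJ hv) (hz.monotone_toLex (blockIndex_mono I)) hmono
  have hinv : ⇑z⁻¹ ∘ ⇑(z * y⁻¹) = ⇑z⁻¹ :=
    comp_eq_self_of_monotone_toLex (fun x => by simp [← hblock])
      (hz'.monotone_toLex monotone_id) (by simpa using hy'.monotone_toLex monotone_id)
  exact inv_injective (Equiv.ext fun x => by simpa using congrFun hinv x)

theorem exists_strictMonoOnBlocks_bruhatLE (hI : I ⊆ simples n) (hJ : J ⊆ simples n)
    (hy : y ∈ dcoset I J w) : ∃ z ∈ dcoset I J w, BruhatLE (simples n) z y ∧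
      StrictMonoOnBlocks J z ∧ StrictMonoOnBlocks I ⇑z⁻¹ := by
  obtain ⟨z, hz, hzy, hleft, hright⟩ := exists_bruhatLE_forall_len_le_mul
    (fun _ => mul_self_of_mem_simples) hI hJ hy
  exact ⟨z, hz, hzy,
    .of_covBy fun i j hij h => apply_lt_apply_of_len_le_mul_swap hij (hright _ h),
    .of_covBy fun i j hij h => inv_apply_lt_inv_apply_of_len_le_swap_mul hij (hleft _ h)⟩

theorem minElt_dcoset_eq (hI : I ⊆ simples n) (hJ : J ⊆ simples n) (hz : z ∈ dcoset I J w)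
    (hmono : StrictMonoOnBlocks J z) (hmono' : StrictMonoOnBlocks I ⇑z⁻¹) :
    minElt (simples n) (dcoset I J w) = z := by
  refine minElt_eq_of_forall_bruhatLE hz fun y hy => ?_
  obtain ⟨v, hv, hvy, hvmono, hvmono'⟩ := exists_strictMonoOnBlocks_bruhatLE hI hJ hy
  rw [← dcoset_eq_of_mem hz] at hv
  rwa [← eq_of_strictMonoOnBlocks hI hJ hv hmono hmono' hvmono hvmono']

theorem exists_bruhatLE_strictAntiOnBlocks (hJ : J ⊆ simples n) (hy : y ∈ dcoset I J w) :
    ∃ z ∈ dcoset I J w, BruhatLE (simples n) y z ∧ StrictAntiOnBlocks J z := by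
  obtain ⟨z, hz, hyz, h⟩ := exists_bruhatLE_forall_len_mul_le hJ hy
  exact ⟨z, hz, hyz,
    .of_covBy fun i j hij hmem => apply_lt_apply_of_len_mul_swap_le hij (h _ hmem)⟩

theorem maxElt_dcoset_eq (hJ : J ⊆ simples n) (hz : z ∈ dcoset I J w)
    (hanti : StrictAntiOnBlocks J z)
    (hcoset : ∀ y ∈ dcoset I J w, z⁻¹ * y ∈ Subgroup.closure J) :
    maxElt (simples n) (dcoset I J w) = z := by
  refine maxElt_eq_of_forall_bruhatLE hz fun y hy => ?_
  obtain ⟨v, hv, hyv, hvanti⟩ := exists_bruhatLE_strictAntiOnBlocks hJ hy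
  have h : z⁻¹ * v = 1 := eq_one_of_strictAntiOnBlocks
    (blockIndex_apply_of_mem_closure hJ (hcoset v hv)) hanti (by rwa [mul_inv_cancel_left])
  rwa [inv_mul_eq_one.1 h]

theorem longest_eq_iff (hJ : J ⊆ simples n) : longest (simples n) J = w ↔
    (∀ x, blockIndex J (w x) = blockIndex J x) ∧ StrictAntiOnBlocks J ⇑w := by
  have heq : ∀ {w : Perm (Fin n)}, (∀ x, blockIndex J (w x) = blockIndex J x) ∧
      StrictAntiOnBlocks J ⇑w → longest (simples n) J = w := by
    rintro w ⟨hw, hanti⟩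
    have hmem := (mem_closure_iff hJ).2 hw
    rw [longest, ← dcoset_self_one]
    refine maxElt_dcoset_eq hJ ?_ hanti fun y hy => ?_
    · rwa [dcoset_self_one]
    · rw [dcoset_self_one] at hy
      exact Subgroup.mul_mem _ (Subgroup.inv_mem _ hmem) hy
  refine ⟨?_, heq⟩
  rintro rfl
  obtain ⟨z, hz, -, hanti⟩ := exists_bruhatLE_strictAntiOnBlocks hJ (self_mem_dcoset J J 1)
  rw [dcoset_self_one] at hz
  have hzJ := And.intro (blockIndex_apply_of_mem_closure hJ hz) hanti
  rwa [heq hzJ]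

theorem blockIndex_longest_apply (hJ : J ⊆ simples n) (x : Fin n) :
    blockIndex J (longest (simples n) J x) = blockIndex J x :=
  ((longest_eq_iff hJ).1 rfl).1 x

theorem strictAntiOnBlocks_longest (hJ : J ⊆ simples n) :
    StrictAntiOnBlocks J ⇑(longest (simples n) J) :=
  ((longest_eq_iff hJ).1 rfl).2

theorem swap_mem_iff_longest_apply_lt (hJ : J ⊆ simples n) {i j : Fin n} (hij : i ⋖ j) :
    swap i j ∈ J ↔ longest (simples n) J j < longest (simples n) J i := by
  refine ⟨fun h => strictAntiOnBlocks_longest hJ hij.lt (blockIndex_eq_of_swap_mem hij h),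
    fun h => ?_⟩
  have hle := blockIndex_mono J h.le
  rw [blockIndex_longest_apply hJ, blockIndex_longest_apply hJ] at hle
  exact (swap_mem_iff_blockIndex_eq hij).2 ((blockIndex_mono J hij.le).antisymm hle)

theorem longest_injOn : Set.InjOn (longest (simples n)) {J | J ⊆ simples n} := by
  intro J hJ K hK h
  ext s
  by_cases hs : s ∈ simples n
  · obtain ⟨i, j, hij, rfl⟩ := mem_simples_iff.1 hs
    rw [swap_mem_iff_longest_apply_lt hJ hij, swap_mem_iff_longest_apply_lt hK hij, h]
  · exact iff_of_false (fun hsJ => hs (hJ hsJ)) fun hsK => hs (hK hsK)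

end Extremal

section CoreElements

variable {n : ℕ} {I J K : Set (Perm (Fin n))} {p : Set (Perm (Fin n))} {w y z z' : Perm (Fin n)}

/-- `z` permutes the components, mapping those of `J` increasingly onto those of `I`. These are
the minimal elements of the core `(I,J)`-cosets. -/
structure IsCoreElt (I J : Set (Perm (Fin n))) (z : Perm (Fin n)) : Prop where
  left_subset : I ⊆ simples n
  right_subset : J ⊆ simples n
  blockIndex_eq_iff : ∀ x y, blockIndex I (z x) = blockIndex I (z y) ↔
    blockIndex J x = blockIndex J y
  strictMonoOnBlocks : StrictMonoOnBlocks J z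

namespace IsCoreElt

theorem one (hJ : J ⊆ simples n) : IsCoreElt J J 1 :=
  ⟨hJ, hJ, fun _ _ => Iff.rfl, fun _ _ h _ => h⟩

theorem inv (h : IsCoreElt I J z) : IsCoreElt J I z⁻¹ where
  left_subset := h.right_subset
  right_subset := h.left_subset
  blockIndex_eq_iff x y := by simp [← h.blockIndex_eq_iff]
  strictMonoOnBlocks x y hxy heq := by
    rw [← h.strictMonoOnBlocks.lt_iff_lt (by simpa [← h.blockIndex_eq_iff] using heq)]
    simpa using hxy

theorem mul (h : IsCoreElt I J z) (h' : IsCoreElt J K z') : IsCoreElt I K (z * z') where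
  left_subset := h.left_subset
  right_subset := h'.right_subset
  blockIndex_eq_iff x y := by simp [h.blockIndex_eq_iff, h'.blockIndex_eq_iff]
  strictMonoOnBlocks x y hxy heq :=
    h.strictMonoOnBlocks (h'.strictMonoOnBlocks hxy heq) ((h'.blockIndex_eq_iff x y).2 heq)

theorem covBy (h : IsCoreElt I J z) {i j : Fin n} (hij : i ⋖ j) (hmem : swap i j ∈ J) :
    z i ⋖ z j := by
  have heq := blockIndex_eq_of_swap_mem hij hmem
  refine ⟨h.strictMonoOnBlocks hij.lt heq, fun k hik hkj => ?_⟩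
  have hIeq := (h.blockIndex_eq_iff i j).2 heq
  have hIk : blockIndex I (z i) = blockIndex I k :=
    (blockIndex_mono I hik.le).antisymm (hIeq ▸ blockIndex_mono I hkj.le)
  have hlt := h.inv.strictMonoOnBlocks hik hIk
  have hlt' := h.inv.strictMonoOnBlocks hkj (hIk.symm.trans hIeq)
  exact hij.2 (by simpa using hlt) (by simpa using hlt')

theorem conj_mem (h : IsCoreElt I J z) {s : Perm (Fin n)} (hs : s ∈ J) : z * s * z⁻¹ ∈ I := by
  obtain ⟨i, j, hij, rfl⟩ := mem_simples_iff.1 (h.right_subset hs)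
  rw [← Equiv.swap_apply_apply, swap_mem_iff_blockIndex_eq (h.covBy hij hs), h.blockIndex_eq_iff]
  exact blockIndex_eq_of_swap_mem hij hs

theorem conj_image (h : IsCoreElt I J z) : (fun s => z * s * z⁻¹) '' J = I := by
  refine Set.Subset.antisymm (Set.image_subset_iff.2 fun s => h.conj_mem) fun s hs => ?_
  exact ⟨z⁻¹ * s * z⁻¹⁻¹, h.inv.conj_mem hs, by group⟩

theorem ncard_eq (h : IsCoreElt I J z) : I.ncard = J.ncard := by
  rw [← h.conj_image]
  exact Set.ncard_image_of_injective J (MulAut.conj z).injective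

theorem minElt_eq (h : IsCoreElt I J z) : minElt (simples n) (dcoset I J z) = z :=
  minElt_dcoset_eq h.left_subset h.right_subset (self_mem_dcoset I J z) h.strictMonoOnBlocks
    h.inv.strictMonoOnBlocks

theorem isCore (h : IsCoreElt I J z) : IsCore (simples n) I J (dcoset I J z) := by
  have himage : (fun s => z⁻¹ * s * z) '' I = J := by simpa using h.inv.conj_image
  refine ⟨⟨h.left_subset, h.right_subset, z, rfl⟩, ?_, ?_⟩
  · rw [leftRed, h.minElt_eq, h.conj_image, Set.inter_self]
  · rw [rightRed, h.minElt_eq, himage, Set.inter_self]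

theorem isBlockPerm (h : IsCoreElt I J z) : IsBlockPerm I J z := by
  intro x
  rw [component_eq, component_eq]
  refine ⟨?_, fun a ha b hb hab => h.strictMonoOnBlocks hab (Eq.trans ha (Eq.symm hb))⟩
  ext y
  simp [Equiv.image_eq_preimage_symm, ← h.blockIndex_eq_iff]

theorem mem_dcoset_iff (h : IsCoreElt I J z) :
    y ∈ dcoset I J z ↔ z⁻¹ * y ∈ Subgroup.closure J := by
  refine ⟨fun hy => ?_, fun hy => ?_⟩
  · obtain ⟨u, hu, v, hv, rfl⟩ := DoubleCoset.mem_doubleCoset.1 hy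
    have hconj : z⁻¹ * u * z ∈ Subgroup.closure J := by
      rw [mem_closure_iff h.right_subset]
      intro x
      rw [← h.blockIndex_eq_iff]
      simpa using blockIndex_apply_of_mem_closure h.left_subset hu (z x)
    simpa [mul_assoc] using Subgroup.mul_mem _ hconj hv
  · simpa using mul_mem_dcoset_right (self_mem_dcoset I J z) hy

theorem maxElt_eq (h : IsCoreElt I J z) :
    maxElt (simples n) (dcoset I J z) = z * longest (simples n) J := by
  have hlongest : longest (simples n) J ∈ Subgroup.closure J :=
    (mem_closure_iff h.right_subset).2 (blockIndex_longest_apply h.right_subset)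
  refine maxElt_dcoset_eq h.right_subset (h.mem_dcoset_iff.2 (by simpa using hlongest)) ?_ ?_
  · intro x y hxy heq
    exact h.strictMonoOnBlocks (strictAntiOnBlocks_longest h.right_subset hxy heq)
      (by simp only [blockIndex_longest_apply h.right_subset, heq])
  · intro y hy
    rw [mul_inv_rev, mul_assoc]
    exact Subgroup.mul_mem _ (Subgroup.inv_mem _ hlongest) (h.mem_dcoset_iff.1 hy)

theorem lenAdd_longest (h : IsCoreElt I J z) :
    LenAdd (simples n) z (longest (simples n) J) := by
  rw [lenAdd_iff]
  intro i j hij hlt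
  have hle := blockIndex_mono J hlt.le
  rw [blockIndex_longest_apply h.right_subset, blockIndex_longest_apply h.right_subset] at hle
  refine h.strictMonoOnBlocks hlt ?_
  simp only [blockIndex_longest_apply h.right_subset]
  exact hle.antisymm (blockIndex_mono J hij.le)

end IsCoreElt

theorem blockIndex_apply_eq_of_conj_mem (hI : I ⊆ simples n) (h : ∀ s ∈ J, z * s * z⁻¹ ∈ I)
    {x y : Fin n} (heq : blockIndex J x = blockIndex J y) :
    blockIndex I (z x) = blockIndex I (z y) := by
  refine apply_eq_of_blockIndex_eq (f := fun x => blockIndex I (z x)) (fun i j _ hmem => ?_) heq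
  have hswap := h _ hmem
  rw [← Equiv.swap_apply_apply] at hswap
  simpa using blockIndex_apply_of_mem_closure hI (Subgroup.subset_closure hswap) (z j)

theorem isCore_iff :
    IsCore (simples n) I J p ↔ ∃ z, IsCoreElt I J z ∧ p = dcoset I J z := by
  refine ⟨?_, fun ⟨z, hz, hp⟩ => hp ▸ hz.isCore⟩
  rintro ⟨⟨hI, hJ, w, rfl⟩, hleft, hright⟩
  obtain ⟨z, hz, -, hmono, hmono'⟩ :=
    exists_strictMonoOnBlocks_bruhatLE hI hJ (self_mem_dcoset I J w)
  rw [leftRed, minElt_dcoset_eq hI hJ hz hmono hmono', Set.inter_eq_left] at hleft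
  rw [rightRed, minElt_dcoset_eq hI hJ hz hmono hmono', Set.inter_eq_right] at hright
  have hconj : ∀ s ∈ I, z⁻¹ * s * z⁻¹⁻¹ ∈ J := fun s hs => by
    obtain ⟨t, ht, rfl⟩ := hleft hs
    simpa [mul_assoc] using ht
  have hconj' : ∀ s ∈ J, z * s * z⁻¹ ∈ I := fun s hs => by
    obtain ⟨t, ht, rfl⟩ := hright hs
    simpa [mul_assoc] using ht
  refine ⟨z, ⟨hI, hJ, fun x y => ⟨fun h => ?_, blockIndex_apply_eq_of_conj_mem hI hconj'⟩, hmono⟩,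
    (dcoset_eq_of_mem hz).symm⟩
  simpa using blockIndex_apply_eq_of_conj_mem hJ hconj h

end CoreElements

section Squash

variable {n m : ℕ} {I J K I' : Set (Perm (Fin n))} {z z' : Perm (Fin n)}
  {w w' : Perm (Fin (n - m))}

theorem IsCoreElt.eq_of_blockIndex_apply_eq (h : IsCoreElt I J z) (h' : IsCoreElt I' J z')
    (heq : ∀ x, blockIndex I (z x) = blockIndex I' (z' x)) : I = I' ∧ z = z' := by
  -- `z` and `z'` both sort the points lexicographically by target component and position.
  let f : Fin n → ℕ ×ₗ Fin n := fun x => toLex (blockIndex I (z x), x)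
  have hf : Monotone (f ∘ ⇑z⁻¹) := by
    simpa [f, Function.comp_def] using h.inv.strictMonoOnBlocks.monotone_toLex monotone_id
  have hf' : Monotone (f ∘ ⇑z'⁻¹) := by
    simpa [f, heq, Function.comp_def] using h'.inv.strictMonoOnBlocks.monotone_toLex monotone_id
  have hcomp : f ∘ ⇑z⁻¹ = f ∘ ⇑z'⁻¹ := Tuple.unique_monotone hf hf'
  obtain rfl : z = z' := inv_injective <| Equiv.ext fun x =>
    congrArg (fun a : ℕ ×ₗ Fin n => (ofLex a).2) (congrFun hcomp x)
  refine ⟨eq_of_blockIndex_eq h.left_subset h'.left_subset (funext fun x => ?_), rfl⟩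
  simpa using heq (z⁻¹ x)

theorem exists_isCoreElt_blockIndex_apply_eq (hJ : J ⊆ simples n) {f : Fin n → ℕ}
    (hf : ∀ x y, f x = f y ↔ blockIndex J x = blockIndex J y)
    (hrange : ∀ x, ∀ c ≤ f x, c ∈ Set.range f) :
    ∃ I z, IsCoreElt I J z ∧ ∀ x, blockIndex I (z x) = f x := by
  let g : Fin n → ℕ ×ₗ Fin n := fun x => toLex (f x, x)
  let σ : Perm (Fin n) := Tuple.sort g
  have hsort : Monotone (g ∘ σ) := Tuple.monotone_sort g
  have hlt : ∀ {x y}, g x < g y → σ⁻¹ x < σ⁻¹ y := fun hxy =>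
    hsort.reflect_lt (by simpa using hxy)
  obtain ⟨I, hI, hblock⟩ := exists_subset_simples_blockIndex_eq (f := f ∘ σ)
    (Prod.Lex.monotone_fst_ofLex.comp hsort)
    (fun x c hc => by rw [σ.surjective.range_comp]; exact hrange _ c hc)
  have happly : ∀ x, blockIndex I (σ⁻¹ x) = f x := fun x => by simp [hblock]
  refine ⟨I, σ⁻¹, ⟨hI, hJ, fun x y => by rw [happly, happly, hf], fun x y hxy heq => hlt ?_⟩,
    happly⟩
  exact Prod.Lex.toLex_lt_toLex.2 (Or.inr ⟨(hf x y).2 heq, hxy⟩)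

theorem exists_blockIndex_eq_val (hJ : J ⊆ simples n) (hm : J.ncard = m) (c : Fin (n - m)) :
    ∃ x, (c : ℕ) = blockIndex J x := by
  subst hm
  obtain ⟨x, hx⟩ := (mem_range_blockIndex_iff hJ).2 c.2
  exact ⟨x, hx.symm⟩

theorem exists_val_eq_blockIndex (hJ : J ⊆ simples n) (hm : J.ncard = m) (x : Fin n) :
    ∃ c : Fin (n - m), (c : ℕ) = blockIndex J x :=
  ⟨⟨_, hm ▸ (mem_range_blockIndex_iff hJ).1 ⟨x, rfl⟩⟩, rfl⟩

theorem isSquash_iff (hJ : J ⊆ simples n) (hm : J.ncard = m) : IsSquash m I J z w ↔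
    ∀ ⦃x⦄ ⦃c : Fin (n - m)⦄, (c : ℕ) = blockIndex J x → (w c : ℕ) = blockIndex I (z x) := by
  simp only [IsSquash, compIndex_eq]
  refine ⟨fun h x c hc => ?_, fun h x => ?_⟩
  · obtain ⟨d, hd, hwd⟩ := h x
    rwa [Fin.ext (hc.trans hd.symm)]
  · obtain ⟨c, hc⟩ := exists_val_eq_blockIndex hJ hm x
    exact ⟨c, hc, h hc⟩

theorem IsSquash.mul (hJ : J ⊆ simples n) (hmJ : J.ncard = m) (hK : K ⊆ simples n)
    (hmK : K.ncard = m) (hw : IsSquash m I J z w) (hw' : IsSquash m J K z' w') :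
    IsSquash m I K (z * z') (w * w') :=
  (isSquash_iff hK hmK).2 fun _ _ hc =>
    (isSquash_iff hJ hmJ).1 hw ((isSquash_iff hK hmK).1 hw' hc)

theorem isSquash_one (hJ : J ⊆ simples n) (hm : J.ncard = m) : IsSquash m J J 1 1 :=
  (isSquash_iff hJ hm).2 fun _ _ hc => hc

namespace IsCoreElt

theorem exists_isSquash (h : IsCoreElt I J z) (hm : J.ncard = m) : ∃ w, IsSquash m I J z w := by
  choose x hx using exists_blockIndex_eq_val h.right_subset hm
  choose b hb using exists_val_eq_blockIndex h.left_subset (h.ncard_eq.trans hm)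
  have hinj : Function.Injective fun c => b (z (x c)) := fun c d hcd => by
    rwa [Fin.ext_iff, hb, hb, h.blockIndex_eq_iff, ← hx, ← hx, ← Fin.ext_iff] at hcd
  refine ⟨Equiv.ofBijective _ (Finite.injective_iff_bijective.1 hinj),
    (isSquash_iff h.right_subset hm).2 fun y c hc => ?_⟩
  rw [Equiv.ofBijective_apply, hb, h.blockIndex_eq_iff, ← hx, hc]

theorem isSquash_squash (h : IsCoreElt I J z) (hm : J.ncard = m) :
    IsSquash m I J z (squash m I J z) := by
  rw [squash, dif_pos (h.exists_isSquash hm)]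
  exact (h.exists_isSquash hm).choose_spec

theorem val_squash_apply (h : IsCoreElt I J z) (hm : J.ncard = m) {x : Fin n} {c : Fin (n - m)}
    (hc : (c : ℕ) = blockIndex J x) : (squash m I J z c : ℕ) = blockIndex I (z x) :=
  (isSquash_iff h.right_subset hm).1 (h.isSquash_squash hm) hc

theorem isSquash_iff_eq_squash (h : IsCoreElt I J z) (hm : J.ncard = m) :
    IsSquash m I J z w ↔ w = squash m I J z := by
  refine ⟨fun hw => Equiv.ext fun c => Fin.ext ?_, fun hw => hw ▸ h.isSquash_squash hm⟩
  obtain ⟨x, hx⟩ := exists_blockIndex_eq_val h.right_subset hm c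
  rw [(isSquash_iff h.right_subset hm).1 hw hx, h.val_squash_apply hm hx]

theorem Sq_dcoset (h : IsCoreElt I J z) : Sq m I J (dcoset I J z) = squash m I J z := by
  rw [Sq, h.minElt_eq]

theorem squash_mul (h : IsCoreElt I J z) (h' : IsCoreElt J K z') (hm : K.ncard = m) :
    squash m I K (z * z') = squash m I J z * squash m J K z' := by
  have hmJ : J.ncard = m := h'.ncard_eq.trans hm
  exact (((h.mul h').isSquash_iff_eq_squash hm).1 ((h.isSquash_squash hmJ).mul h'.left_subset hmJ
    h'.right_subset hm (h'.isSquash_squash hm))).symm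

end IsCoreElt

theorem squash_one (hJ : J ⊆ simples n) (hm : J.ncard = m) : squash m J J 1 = 1 :=
  (((IsCoreElt.one hJ).isSquash_iff_eq_squash hm).1 (isSquash_one hJ hm)).symm

namespace IsCoreElt

theorem squash_inv (h : IsCoreElt I J z) (hm : J.ncard = m) :
    squash m J I z⁻¹ = (squash m I J z)⁻¹ := by
  rw [eq_inv_iff_mul_eq_one, ← h.inv.squash_mul h hm, inv_mul_cancel, squash_one h.right_subset hm]

theorem lenAdd_iff_lenAdd_squash (h : IsCoreElt I J z) (h' : IsCoreElt J K z')
    (hm : K.ncard = m) : LenAdd (simples n) z z' ↔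
      LenAdd (simples (n - m)) (squash m I J z) (squash m J K z') := by
  have hmJ : J.ncard = m := h'.ncard_eq.trans hm
  rw [lenAdd_iff, lenAdd_iff]
  constructor
  · intro hz c d hcd hlt
    obtain ⟨i, hi⟩ := exists_blockIndex_eq_val h'.right_subset hm c
    obtain ⟨j, hj⟩ := exists_blockIndex_eq_val h'.right_subset hm d
    rw [Fin.lt_def, h'.val_squash_apply hm hi, h'.val_squash_apply hm hj] at hlt
    rw [Fin.lt_def, h.val_squash_apply hmJ (h'.val_squash_apply hm hi),
      h.val_squash_apply hmJ (h'.val_squash_apply hm hj)]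
    rw [Fin.lt_def, hi, hj] at hcd
    have hle := blockIndex_mono I (hz i j (lt_of_blockIndex_lt hcd) (lt_of_blockIndex_lt hlt)).le
    refine hle.lt_of_ne fun heq => hlt.ne ?_
    rwa [h.blockIndex_eq_iff] at heq
  · intro hz i j hij hlt
    obtain ⟨c, hc⟩ := exists_val_eq_blockIndex h'.right_subset hm i
    obtain ⟨d, hd⟩ := exists_val_eq_blockIndex h'.right_subset hm j
    have hne : blockIndex K i ≠ blockIndex K j := fun heq =>
      hlt.asymm (h'.strictMonoOnBlocks hij heq)
    have hne' : blockIndex J (z' j) ≠ blockIndex J (z' i) := fun heq =>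
      hne ((h'.blockIndex_eq_iff j i).1 heq).symm
    have hcd : c < d := by
      rw [Fin.lt_def, hc, hd]
      exact (blockIndex_mono K hij.le).lt_of_ne hne
    have hdc : squash m J K z' d < squash m J K z' c := by
      rw [Fin.lt_def, h'.val_squash_apply hm hc, h'.val_squash_apply hm hd]
      exact (blockIndex_mono J hlt.le).lt_of_ne hne'
    have hzlt := hz c d hcd hdc
    rw [Fin.lt_def, h.val_squash_apply hmJ (h'.val_squash_apply hm hc),
      h.val_squash_apply hmJ (h'.val_squash_apply hm hd)] at hzlt
    exact lt_of_blockIndex_lt hzlt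

theorem eq_of_squash_eq_left (h : IsCoreElt I J z) (h' : IsCoreElt I' J z') (hm : J.ncard = m)
    (heq : squash m I J z = squash m I' J z') : I = I' ∧ z = z' := by
  refine h.eq_of_blockIndex_apply_eq h' fun x => ?_
  obtain ⟨c, hc⟩ := exists_val_eq_blockIndex h.right_subset hm x
  rw [← h.val_squash_apply hm hc, ← h'.val_squash_apply hm hc, heq]

theorem eq_of_squash_eq_right (h : IsCoreElt J I z) (h' : IsCoreElt J I' z') (hm : J.ncard = m)
    (heq : squash m J I z = squash m J I' z') : I = I' ∧ z = z' := by
  obtain ⟨rfl, hinv⟩ := h.inv.eq_of_squash_eq_left h'.inv hm <| by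
    rw [h.squash_inv (h.ncard_eq.symm.trans hm), h'.squash_inv (h'.ncard_eq.symm.trans hm), heq]
  exact ⟨rfl, inv_injective hinv⟩

end IsCoreElt

theorem exists_squash_eq_left (hJ : J ⊆ simples n) (hm : J.ncard = m) (w : Perm (Fin (n - m))) :
    ∃ I z, IsCoreElt I J z ∧ squash m I J z = w := by
  choose b hb using exists_val_eq_blockIndex hJ hm
  obtain ⟨I, z, hz, hblock⟩ := exists_isCoreElt_blockIndex_apply_eq (f := fun x => (w (b x) : ℕ))
    hJ (fun x y => by rw [Fin.val_inj, w.injective.eq_iff, Fin.ext_iff, hb, hb]) <| by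
      intro x c hc
      obtain ⟨y, hy⟩ := exists_blockIndex_eq_val hJ hm (w⁻¹ ⟨c, hc.trans_lt (w (b x)).2⟩)
      rw [← hb, Fin.val_inj, Equiv.Perm.inv_eq_iff_eq, Fin.ext_iff] at hy
      exact ⟨y, hy.symm⟩
  refine ⟨I, z, hz, ((hz.isSquash_iff_eq_squash hm).1 ?_).symm⟩
  refine (isSquash_iff hJ hm).2 fun x c hc => ?_
  rw [hblock, Fin.ext (hc.trans (hb x).symm)]

theorem exists_squash_eq_right (hI : I ⊆ simples n) (hm : I.ncard = m) (w : Perm (Fin (n - m))) :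
    ∃ J z, IsCoreElt I J z ∧ squash m I J z = w := by
  obtain ⟨J, z, hz, hsq⟩ := exists_squash_eq_left hI hm w⁻¹
  exact ⟨J, z⁻¹, hz.inv, by rw [hz.squash_inv hm, hsq, inv_inv]⟩

end Squash

section Atomic

variable {n m : ℕ} {I J K : Set (Perm (Fin n))} {p : Set (Perm (Fin n))} {z : Perm (Fin n)}
  {c d : Fin (n - m)}

/-- The monotone surjection of `ℕ` identifying `c` and `c + 1` only. It renumbers the components
of `J` when those with numbers `c` and `c + 1` are merged. -/
def merge (c a : ℕ) : ℕ := if a ≤ c then a else a - 1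

theorem merge_mono (c : ℕ) : Monotone (merge c) := by
  intro a b hab
  unfold merge
  split_ifs <;> lia

theorem merge_eq_merge_iff {c a b : ℕ} (hab : a < b) :
    merge c a = merge c b ↔ a = c ∧ b = c + 1 := by
  unfold merge
  split_ifs <;> lia

theorem merge_swap_apply (hcd : c ⋖ d) (a : Fin (n - m)) : merge c (swap c d a) = merge c a := by
  have hmerge : merge c d = merge c c :=
    ((merge_eq_merge_iff hcd.lt).2 ⟨rfl, covBy_iff_val_eq.1 hcd⟩).symm
  rw [Equiv.swap_apply_def]
  split_ifs with hac had
  · rw [hac, hmerge]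
  · rw [had, hmerge]
  · rfl

theorem eq_of_swap_notMem_of_blockIndex_eq {i j i' j' : Fin n} (hij : i ⋖ j) (hij' : i' ⋖ j')
    (h : swap i j ∉ J) (h' : swap i' j' ∉ J) (heq : blockIndex J i = blockIndex J i') :
    i = i' := by
  have hj := blockIndex_eq_add_one_of_swap_notMem hij h
  have hj' := blockIndex_eq_add_one_of_swap_notMem hij' h'
  rcases lt_trichotomy i i' with hlt | heq' | hlt
  · have := blockIndex_mono J (hij.ge_of_gt hlt)
    lia
  · exact heq'
  · have := blockIndex_mono J (hij'.ge_of_gt hlt)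
    lia

theorem blockIndex_union_swap {i j : Fin n} (hij : i ⋖ j) (h : swap i j ∉ J) (x : Fin n) :
    blockIndex (J ∪ {swap i j}) x = merge (blockIndex J i) (blockIndex J x) := by
  refine congrFun (eq_blockIndex (f := fun x => merge (blockIndex J i) (blockIndex J x))
    (fun x hx => ?_) (fun i' j' hij' hmem => ?_) fun i' j' hij' hnotMem => ?_).symm x
  · simp [blockIndex_of_isMin hx, merge]
  · rcases hmem with hmem | heq
    · rw [blockIndex_eq_of_swap_mem hij' hmem]
    · obtain ⟨rfl, rfl⟩ := swap_inj_of_lt hij'.lt hij.lt heq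
      have hj := blockIndex_eq_add_one_of_swap_notMem hij h
      exact (merge_eq_merge_iff (by lia)).2 ⟨rfl, hj⟩
  · have hnotMem' : swap i' j' ∉ J := fun hmem => hnotMem (Or.inl hmem)
    have hne : blockIndex J i' ≠ blockIndex J i := fun heq => by
      obtain rfl := eq_of_swap_notMem_of_blockIndex_eq hij' hij hnotMem' h heq
      rw [hij'.unique_right hij] at hnotMem
      exact hnotMem (Or.inr rfl)
    rw [blockIndex_eq_add_one_of_swap_notMem hij' hnotMem']
    unfold merge
    split_ifs <;> lia

namespace IsCoreElt

theorem isReducedExpr_iff (h : IsCoreElt I J z) :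
    IsReducedExpr (simples n) I J (dcoset I J z) [(K, J)] ↔
      I ⊆ K ∧ J ⊆ K ∧ K ⊆ simples n ∧ z * longest (simples n) J = longest (simples n) K := by
  simp only [IsReducedExpr, IsExpr, exprElt, exprLen, h.maxElt_eq, inv_mul_cancel_right]
  refine ⟨fun ⟨_, ⟨hIK, hJK, hK, _⟩, heq, _⟩ => ⟨hIK, hJK, hK, heq⟩, ?_⟩
  rintro ⟨hIK, hJK, hK, heq⟩
  exact ⟨h.isCore.1, ⟨hIK, hJK, hK, h.right_subset, trivial⟩, heq, by rw [heq]; ring⟩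

theorem blockIndex_eq_merge (h : IsCoreElt I J z) (hm : J.ncard = m) (hcd : c ⋖ d)
    (hsq : squash m I J z = swap c d) (hKJ : ∀ x, blockIndex K x = merge c (blockIndex J x))
    (x : Fin n) : blockIndex K x = merge c (blockIndex I x) := by
  have happly : (fun x => merge c (blockIndex I x)) ∘ z = blockIndex K := funext fun x => by
    obtain ⟨a, ha⟩ := exists_val_eq_blockIndex h.right_subset hm x
    rw [Function.comp_apply, ← h.val_squash_apply hm ha, hsq, merge_swap_apply hcd, ha, hKJ]
  have hmono : Monotone fun x => merge c (blockIndex I x) :=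
    (merge_mono c).comp (blockIndex_mono I)
  have hcomp := Tuple.unique_monotone (f := fun x => merge c (blockIndex I x)) (σ := z) (τ := 1)
    (happly.symm ▸ blockIndex_mono K) hmono
  exact congrFun (happly.symm.trans hcomp) x

theorem mul_longest_eq (h : IsCoreElt I J z) (hm : J.ncard = m) (hcd : c ⋖ d)
    (hsq : squash m I J z = swap c d) (hK : K ⊆ simples n)
    (hKJ : ∀ x, blockIndex K x = merge c (blockIndex J x)) :
    z * longest (simples n) J = longest (simples n) K := by
  refine ((longest_eq_iff hK).2 ⟨fun x => ?_, fun x y hxy heq => ?_⟩).symm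
  · obtain ⟨a, ha⟩ := exists_val_eq_blockIndex h.right_subset hm (longest (simples n) J x)
    rw [Equiv.Perm.mul_apply, h.blockIndex_eq_merge hm hcd hsq hKJ, ← h.val_squash_apply hm ha,
      hsq, merge_swap_apply hcd, ha, blockIndex_longest_apply h.right_subset, hKJ]
  · rw [hKJ, hKJ] at heq
    rcases (blockIndex_mono J hxy.le).lt_or_eq with hlt | hJeq
    · obtain ⟨hx, hy⟩ := (merge_eq_merge_iff hlt).1 heq
      rw [← blockIndex_longest_apply h.right_subset] at hx
      rw [← covBy_iff_val_eq.1 hcd, ← blockIndex_longest_apply h.right_subset] at hy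
      refine lt_of_blockIndex_lt (J := I) ?_
      rw [Equiv.Perm.mul_apply, Equiv.Perm.mul_apply, ← h.val_squash_apply hm hx.symm,
        ← h.val_squash_apply hm hy.symm, hsq, Equiv.swap_apply_left, Equiv.swap_apply_right]
      exact hcd.lt
    · refine h.strictMonoOnBlocks (strictAntiOnBlocks_longest h.right_subset hxy hJeq) ?_
      rw [blockIndex_longest_apply h.right_subset, blockIndex_longest_apply h.right_subset, hJeq]

theorem squash_eq_swap_iff (h : IsCoreElt I J z) (hm : J.ncard = m) (hcd : c ⋖ d)
    (hK : K ⊆ simples n) (hKJ : ∀ x, blockIndex K x = merge c (blockIndex J x)) :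
    squash m I J z = swap c d ↔ z * longest (simples n) J = longest (simples n) K := by
  refine ⟨fun hsq => h.mul_longest_eq hm hcd hsq hK hKJ, fun heq => ?_⟩
  obtain ⟨I', z', hz', hsq⟩ := exists_squash_eq_left h.right_subset hm (swap c d)
  obtain rfl := mul_right_cancel (heq.trans (hz'.mul_longest_eq hm hcd hsq hK hKJ).symm)
  rwa [← h.conj_image, hz'.conj_image]

theorem squash_mem_simples_of_isAtomic (h : IsCoreElt I J z) (hm : J.ncard = m)
    (hatomic : IsAtomic (simples n) I J (dcoset I J z)) : squash m I J z ∈ simples (n - m) := by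
  obtain ⟨-, s, -, t, ht, -, htK, hJ, hred⟩ := hatomic
  obtain ⟨-, -, hK, heq⟩ := h.isReducedExpr_iff.1 hred
  have htJ : t ∉ J := hJ ▸ fun hmem => hmem.2 rfl
  have hunion : I ∪ {s} = J ∪ {t} := by
    rw [hJ, Set.sdiff_union_of_subset (Set.singleton_subset_iff.2 htK)]
  obtain ⟨i, j, hij, rfl⟩ := mem_simples_iff.1 ht
  obtain ⟨c, hc⟩ := exists_val_eq_blockIndex h.right_subset hm i
  obtain ⟨d, hd⟩ := exists_val_eq_blockIndex h.right_subset hm j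
  have hcd : c ⋖ d := by
    rw [covBy_iff_val_eq, hc, hd, blockIndex_eq_add_one_of_swap_notMem hij htJ]
  have hblock : ∀ x, blockIndex (I ∪ {s}) x = merge c (blockIndex J x) := fun x => by
    rw [hunion, blockIndex_union_swap hij htJ, hc]
  rw [(h.squash_eq_swap_iff hm hcd hK hblock).2 heq]
  exact swap_mem_simples hcd

theorem isAtomic_of_squash_mem_simples (h : IsCoreElt I J z) (hm : J.ncard = m)
    (hmem : squash m I J z ∈ simples (n - m)) : IsAtomic (simples n) I J (dcoset I J z) := by
  obtain ⟨c, d, hcd, hsq⟩ := mem_simples_iff.1 hmem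
  obtain ⟨x, hx⟩ := exists_blockIndex_eq_val h.right_subset hm d
  obtain ⟨i, j, hij, hi, hj⟩ := exists_blockIndex_jump (hx ▸ hcd.lt : (c : ℕ) < blockIndex J x)
  have ht := swap_mem_simples hij
  have htJ : swap i j ∉ J := fun hmem => by
    have := blockIndex_eq_of_swap_mem hij hmem
    lia
  have hK : J ∪ {swap i j} ⊆ simples n :=
    Set.union_subset h.right_subset (Set.singleton_subset_iff.2 ht)
  have hKJ : ∀ x, blockIndex (J ∪ {swap i j}) x = merge c (blockIndex J x) := fun x => by
    rw [blockIndex_union_swap hij htJ, hi]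
  have hIK : I ⊆ J ∪ {swap i j} := (subset_iff_blockIndex_eq h.left_subset).2 fun x y heq => by
    simp only [h.blockIndex_eq_merge hm hcd hsq hKJ, heq]
  obtain ⟨s, hsI, hs⟩ : ∃ s ∉ I, insert s I = J ∪ {swap i j} := by
    rw [Set.exists_eq_insert_iff_ncard, Set.union_singleton, Set.ncard_insert_of_notMem htJ,
      h.ncard_eq]
    exact ⟨Set.union_singleton ▸ hIK, rfl⟩
  rw [← Set.union_singleton] at hs
  refine ⟨h.isCore, s, hK (hs ▸ Or.inr rfl), _, ht, hsI, hs ▸ Or.inr rfl, ?_, ?_⟩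
  · rw [hs, Set.union_sdiff_cancel_right (by simpa using htJ)]
  · rw [hs, h.isReducedExpr_iff]
    exact ⟨hIK, Set.subset_union_left, hK, h.mul_longest_eq hm hcd hsq hK hKJ⟩

theorem isAtomic_iff (h : IsCoreElt I J z) (hm : J.ncard = m) :
    IsAtomic (simples n) I J (dcoset I J z) ↔ squash m I J z ∈ simples (n - m) :=
  ⟨h.squash_mem_simples_of_isAtomic hm, h.isAtomic_of_squash_mem_simples hm⟩

end IsCoreElt

theorem Sq_mem_simples (hm : J.ncard = m) (hp : IsAtomic (simples n) I J p) :
    Sq m I J p ∈ simples (n - m) := by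
  obtain ⟨z, hz, rfl⟩ := isCore_iff.1 hp.1
  rw [hz.Sq_dcoset]
  exact (hz.isAtomic_iff hm).1 hp

theorem bijOn_Sq_isAtomic (hJ : J ⊆ simples n) (hm : J.ncard = m) :
    Set.BijOn (fun a : Set (Perm (Fin n)) × Set (Perm (Fin n)) => Sq m a.1 J a.2)
      {a | IsAtomic (simples n) a.1 J a.2} (simples (n - m)) := by
  refine ⟨fun a => Sq_mem_simples hm, ?_, fun w hw => ?_⟩
  · rintro ⟨I, p⟩ (hp : IsAtomic _ I J p) ⟨I', p'⟩ (hp' : IsAtomic _ I' J p') heq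
    obtain ⟨z, hz, rfl⟩ := isCore_iff.1 hp.1
    obtain ⟨z', hz', rfl⟩ := isCore_iff.1 hp'.1
    simp only [hz.Sq_dcoset, hz'.Sq_dcoset] at heq
    obtain ⟨rfl, rfl⟩ := hz.eq_of_squash_eq_left hz' hm heq
    rfl
  · obtain ⟨I, z, hz, rfl⟩ := exists_squash_eq_left hJ hm w
    exact ⟨(I, dcoset I J z), (hz.isAtomic_iff hm).2 hw, hz.Sq_dcoset⟩

end Atomic

section Expressions

variable {n m : ℕ} {I J K I' J' : Set (Perm (Fin n))} {r : Set (Perm (Fin n))}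
  {z z' : Perm (Fin n)} {l l' : List (Set (Perm (Fin n)) × Set (Perm (Fin n)))}

namespace IsCoreElt

theorem dcoset_mul_longest (h : IsCoreElt I J z) :
    dcoset I J (z * longest (simples n) J) = dcoset I J z := by
  rw [← h.maxElt_eq]
  refine dcoset_eq_of_mem (h.mem_dcoset_iff.2 ?_)
  rw [h.maxElt_eq, inv_mul_cancel_left, mem_closure_iff h.right_subset]
  exact blockIndex_longest_apply h.right_subset

theorem lenAdd_and_eq_of_isReducedProd (h : IsCoreElt I J z) (h' : IsCoreElt J K z')
    (hr : IsReducedProd (simples n) I J K r (dcoset I J z) (dcoset J K z')) :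
    LenAdd (simples n) z z' ∧ r = dcoset I K (z * z') := by
  obtain ⟨⟨hadd, -, hstar⟩, rfl⟩ := hr
  rw [h.maxElt_eq, h'.maxElt_eq, mul_inv_cancel_right] at hadd hstar
  have hlen' := h'.lenAdd_longest
  have hlen := (h.mul h').lenAdd_longest
  have hle := len_mul_le z z'
  unfold LenAdd at hadd hlen hlen' ⊢
  rw [← mul_assoc] at hadd hstar
  refine ⟨by lia, ?_⟩
  rw [h.maxElt_eq, h'.maxElt_eq, hstar, (h.mul h').dcoset_mul_longest]

theorem sqExpr_cons (h : IsCoreElt I I' z)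
    (hred : IsReducedExpr (simples n) I I' (dcoset I I' z) [(K, I')]) :
    sqExpr m I ((K, I') :: l) = squash m I I' z :: sqExpr m I' l := by
  rw [sqExpr, ← (h.isReducedExpr_iff.1 hred).2.2.2, h.dcoset_mul_longest, h.Sq_dcoset]

theorem exprLen_cons (h : IsCoreElt I I' z)
    (hred : IsReducedExpr (simples n) I I' (dcoset I I' z) [(K, I')]) :
    exprLen (simples n) I ((K, I') :: l) = len (simples n) z + exprLen (simples n) I' l := by
  have hlen := h.lenAdd_longest
  rw [LenAdd, (h.isReducedExpr_iff.1 hred).2.2.2] at hlen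
  rw [exprLen, hlen]
  lia

end IsCoreElt

/-- `IsAtomicPath I J l z`: the expression `l` from `I` to `J` is a composition of reduced
expressions of atomic cosets, whose minimal elements have product `z`. -/
inductive IsAtomicPath : Set (Perm (Fin n)) → Set (Perm (Fin n)) →
    List (Set (Perm (Fin n)) × Set (Perm (Fin n))) → Perm (Fin n) → Prop
  | nil {J : Set (Perm (Fin n))} (hJ : J ⊆ simples n) : IsAtomicPath J J [] 1
  | cons {I K I' J : Set (Perm (Fin n))} {z z' : Perm (Fin n)}
      {l : List (Set (Perm (Fin n)) × Set (Perm (Fin n)))} (isCoreElt : IsCoreElt I I' z)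
      (isAtomic : IsAtomic (simples n) I I' (dcoset I I' z))
      (isReducedExpr : IsReducedExpr (simples n) I I' (dcoset I I' z) [(K, I')])
      (tail : IsAtomicPath I' J l z') : IsAtomicPath I J ((K, I') :: l) (z * z')

theorem exists_isAtomicPath (hl : IsExpr (simples n) I J l) (ha : AtomicSteps (simples n) I l) :
    ∃ z, IsAtomicPath I J l z := by
  induction l generalizing I with
  | nil =>
    obtain ⟨hI, rfl⟩ := hl
    exact ⟨1, .nil hI⟩
  | cons a l ih =>
    obtain ⟨K, I'⟩ := a
    obtain ⟨⟨q, hq, hred⟩, ha⟩ := ha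
    obtain ⟨z, hz, rfl⟩ := isCore_iff.1 hq.1
    obtain ⟨z', hz'⟩ := ih hl.2.2.2 ha
    exact ⟨z * z', .cons hz hq hred hz'⟩

theorem exists_isAtomicPath_sqExpr_eq {ws : List (Perm (Fin (n - m)))}
    (hws : ∀ w ∈ ws, w ∈ simples (n - m)) (hI : I ⊆ simples n) (hm : I.ncard = m) :
    ∃ J l z, IsAtomicPath I J l z ∧ sqExpr m I l = ws := by
  induction ws generalizing I with
  | nil => exact ⟨I, [], 1, .nil hI, rfl⟩
  | cons w ws ih =>
    obtain ⟨hw, htail⟩ := List.forall_mem_cons.1 hws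
    obtain ⟨I', z, hz, rfl⟩ := exists_squash_eq_right hI hm w
    have hm' : I'.ncard = m := hz.ncard_eq.symm.trans hm
    have hatomic := (hz.isAtomic_iff hm').2 hw
    obtain ⟨s, -, t, -, -, -, -, hred⟩ := hatomic.2
    obtain ⟨J, l, z', hpath, rfl⟩ := ih htail hz.right_subset hm'
    exact ⟨J, _, _, .cons hz hatomic hred hpath, hz.sqExpr_cons hred⟩

namespace IsAtomicPath

theorem isCoreElt (h : IsAtomicPath I J l z) : IsCoreElt I J z := by
  induction h with
  | nil hJ => exact .one hJ
  | cons hz _ _ _ ih => exact hz.mul ih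

theorem isExpr (h : IsAtomicPath I J l z) : IsExpr (simples n) I J l := by
  induction h with
  | nil hJ => exact ⟨hJ, rfl⟩
  | cons hz _ hred _ ih =>
    obtain ⟨hIK, hIK', hK, -⟩ := hz.isReducedExpr_iff.1 hred
    exact ⟨hIK, hIK', hK, ih⟩

theorem atomicSteps (h : IsAtomicPath I J l z) : AtomicSteps (simples n) I l := by
  induction h with
  | nil => trivial
  | cons _ hatomic hred _ ih => exact ⟨⟨_, hatomic, hred⟩, ih⟩

theorem exprElt_eq (h : IsAtomicPath I J l z) :
    exprElt (simples n) I l = z * longest (simples n) J := by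
  induction h with
  | nil => rw [exprElt, one_mul]
  | cons hz _ hred _ ih =>
    rw [exprElt, ih, ← (hz.isReducedExpr_iff.1 hred).2.2.2, mul_inv_cancel_right, mul_assoc]

theorem prod_sqExpr (h : IsAtomicPath I J l z) (hm : I.ncard = m) :
    (sqExpr m I l).prod = squash m I J z := by
  induction h with
  | nil hJ => rw [sqExpr, List.prod_nil, squash_one hJ hm]
  | cons hz _ hred hpath ih =>
    have hm' := hz.ncard_eq.symm.trans hm
    rw [hz.sqExpr_cons hred, List.prod_cons, ih hm',
      hz.squash_mul hpath.isCoreElt (hpath.isCoreElt.ncard_eq.symm.trans hm')]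

theorem mem_simples_of_mem_sqExpr (h : IsAtomicPath I J l z) (hm : I.ncard = m) :
    ∀ w ∈ sqExpr m I l, w ∈ simples (n - m) := by
  induction h with
  | nil => simp [sqExpr]
  | cons hz hatomic hred _ ih =>
    have hm' := hz.ncard_eq.symm.trans hm
    rw [hz.sqExpr_cons hred, List.forall_mem_cons]
    exact ⟨(hz.isAtomic_iff hm').1 hatomic, ih hm'⟩

theorem len_squash_le (h : IsAtomicPath I J l z) (hm : I.ncard = m) :
    len (simples (n - m)) (squash m I J z) ≤ (sqExpr m I l).length :=
  h.prod_sqExpr hm ▸ len_prod_le (h.mem_simples_of_mem_sqExpr hm)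

theorem len_le_exprLen (h : IsAtomicPath I J l z) :
    (len (simples n) (z * longest (simples n) J) : ℤ) ≤ exprLen (simples n) I l := by
  induction h with
  | nil => rw [one_mul, exprLen]
  | @cons _ _ _ J z z' _ hz _ hred _ ih =>
    have hle := len_mul_le z (z' * longest (simples n) J)
    rw [hz.exprLen_cons hred, mul_assoc]
    lia

theorem exprLen_eq_len_iff (h : IsAtomicPath I J l z) (hm : I.ncard = m) :
    exprLen (simples n) I l = len (simples n) (z * longest (simples n) J) ↔
      (sqExpr m I l).length = len (simples (n - m)) (squash m I J z) := by
  induction h with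
  | nil hJ => simp [exprLen, sqExpr, squash_one hJ hm, len_one]
  | @cons I _ I' J z z' _ hz hatomic hred hpath ih =>
    have hm' := hz.ncard_eq.symm.trans hm
    have hz' := hpath.isCoreElt
    have hmJ := hz'.ncard_eq.symm.trans hm'
    have hlen := (hz.mul hz').lenAdd_longest
    have hlen' := hz'.lenAdd_longest
    have hle := len_mul_le z z'
    have hle' := hpath.len_le_exprLen
    have hsqle := len_mul_le (squash m I I' z) (squash m I' J z')
    have hsqle' := hpath.len_squash_le hm'
    have hone := len_of_mem_simples ((hz.isAtomic_iff hm').1 hatomic)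
    have hiff := hz.lenAdd_iff_lenAdd_squash hz' hmJ
    specialize ih hm'
    unfold LenAdd at hlen hlen' hiff
    rw [hz.exprLen_cons hred, hz.sqExpr_cons hred, hz.squash_mul hz' hmJ, List.length_cons]
    lia

theorem eq_of_sqExpr_eq (h : IsAtomicPath I J l z) (h' : IsAtomicPath I J' l' z')
    (hm : I.ncard = m) (heq : sqExpr m I l = sqExpr m I l') : l = l' := by
  induction h generalizing l' z' with
  | nil =>
    cases h' with
    | nil => rfl
    | cons => simp [sqExpr] at heq
  | cons hz _ hred _ ih =>
    cases h' with
    | nil => simp [sqExpr] at heq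
    | cons hz' _ hred' hpath' =>
      rw [hz.sqExpr_cons hred, hz'.sqExpr_cons hred', List.cons.injEq] at heq
      obtain ⟨rfl, rfl⟩ := hz.eq_of_squash_eq_right hz' hm heq.1
      obtain ⟨-, -, hK, hlongest⟩ := hz.isReducedExpr_iff.1 hred
      obtain ⟨-, -, hK', hlongest'⟩ := hz.isReducedExpr_iff.1 hred'
      obtain rfl := longest_injOn hK hK' (hlongest.symm.trans hlongest')
      rw [ih hpath' (hz.ncard_eq.symm.trans hm) heq.2]

end IsAtomicPath

namespace IsCoreElt

theorem isAtomicRex_iff (h : IsCoreElt I J z) :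
    IsAtomicRex (simples n) I J (dcoset I J z) l ↔ IsAtomicPath I J l z ∧
      exprLen (simples n) I l = len (simples n) (z * longest (simples n) J) := by
  refine ⟨fun ⟨⟨_, hl, helt, hlen⟩, ha⟩ => ?_, fun ⟨hpath, hlen⟩ => ?_⟩
  · rw [h.maxElt_eq] at helt hlen
    obtain ⟨z', hpath⟩ := exists_isAtomicPath hl ha
    obtain rfl := mul_right_cancel (helt.trans hpath.exprElt_eq)
    exact ⟨hpath, hlen.symm⟩
  · exact ⟨⟨h.isCore.1, hpath.isExpr, by rw [h.maxElt_eq, hpath.exprElt_eq],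
      by rw [h.maxElt_eq, hlen]⟩, hpath.atomicSteps⟩

theorem bijOn_sqExpr (h : IsCoreElt I J z) (hm : I.ncard = m) :
    Set.BijOn (sqExpr m I) {l | IsAtomicRex (simples n) I J (dcoset I J z) l}
      {l | IsRex (simples (n - m)) (squash m I J z) l} := by
  refine ⟨fun l hl => ?_, fun l hl l' hl' heq => ?_, ?_⟩
  · obtain ⟨hpath, hlen⟩ := h.isAtomicRex_iff.1 hl
    exact ⟨hpath.mem_simples_of_mem_sqExpr hm, hpath.prod_sqExpr hm,
      (hpath.exprLen_eq_len_iff hm).1 hlen⟩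
  · exact (h.isAtomicRex_iff.1 hl).1.eq_of_sqExpr_eq (h.isAtomicRex_iff.1 hl').1 hm heq
  · rintro ws ⟨hws, hprod, hlen⟩
    obtain ⟨J', l, z', hpath, rfl⟩ := exists_isAtomicPath_sqExpr_eq hws h.left_subset hm
    rw [hpath.prod_sqExpr hm] at hprod
    obtain ⟨rfl, rfl⟩ := hpath.isCoreElt.eq_of_squash_eq_right h hm hprod
    exact ⟨l, h.isAtomicRex_iff.2 ⟨hpath, (hpath.exprLen_eq_len_iff hm).2 hlen⟩, rfl⟩

end IsCoreElt

end Expressions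

end CoreCoset

theorem mainTheorem4 (n m : ℕ) :
    -- a core coset has a well-defined squashed permutation
    (∀ I J p : Set (Equiv.Perm (Fin n)), J.ncard = m → CoreCoset.IsCore (CoreCoset.simples n) I J p →
      I.ncard = m ∧
      CoreCoset.IsBlockPerm I J (CoreCoset.minElt (CoreCoset.simples n) p) ∧
      ∀ w : Equiv.Perm (Fin (n - m)),
        CoreCoset.IsSquash m I J (CoreCoset.minElt (CoreCoset.simples n) p) w ↔
          w = CoreCoset.Sq m I J p) ∧
    -- squashing is a bijection from atomic reduced expressions to ordinary reduced expressions
    (∀ I J p : Set (Equiv.Perm (Fin n)), J.ncard = m → CoreCoset.IsCore (CoreCoset.simples n) I J p →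
      Set.BijOn (CoreCoset.sqExpr m I)
        {l | CoreCoset.IsAtomicRex (CoreCoset.simples n) I J p l}
        {l | CoreCoset.IsRex (CoreCoset.simples (n - m)) (CoreCoset.Sq m I J p) l}) ∧
    -- atomic cosets are sent to simple reflections
    (∀ I J p : Set (Equiv.Perm (Fin n)), J.ncard = m →
      CoreCoset.IsAtomic (CoreCoset.simples n) I J p →
      CoreCoset.Sq m I J p ∈ CoreCoset.simples (n - m)) ∧
    -- for fixed `J`, this is a bijection from atomic `(I,J)`-cosets, `I` varying
    (∀ J : Set (Equiv.Perm (Fin n)), J ⊆ CoreCoset.simples n → J.ncard = m →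
      Set.BijOn
        (fun a : Set (Equiv.Perm (Fin n)) × Set (Equiv.Perm (Fin n)) =>
          CoreCoset.Sq m a.1 J a.2)
        {a | CoreCoset.IsAtomic (CoreCoset.simples n) a.1 J a.2}
        (CoreCoset.simples (n - m))) ∧
    -- reduced compositions of core cosets are sent to reduced products
    (∀ I J K r p q : Set (Equiv.Perm (Fin n)), J.ncard = m →
      CoreCoset.IsCore (CoreCoset.simples n) I J p →
      CoreCoset.IsCore (CoreCoset.simples n) J K q →
      CoreCoset.IsReducedProd (CoreCoset.simples n) I J K r p q →
      CoreCoset.IsCore (CoreCoset.simples n) I K r ∧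
      CoreCoset.Sq m I K r = CoreCoset.Sq m I J p * CoreCoset.Sq m J K q ∧
      CoreCoset.LenAdd (CoreCoset.simples (n - m))
        (CoreCoset.Sq m I J p) (CoreCoset.Sq m J K q)) := by
  refine ⟨?_, ?_, fun I J p => CoreCoset.Sq_mem_simples,
    fun J hJ hm => CoreCoset.bijOn_Sq_isAtomic hJ hm, ?_⟩
  · intro I J p hm hp
    obtain ⟨z, hz, rfl⟩ := CoreCoset.isCore_iff.1 hp
    rw [hz.minElt_eq, hz.Sq_dcoset]
    exact ⟨hz.ncard_eq.trans hm, hz.isBlockPerm, fun w => hz.isSquash_iff_eq_squash hm⟩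
  · intro I J p hm hp
    obtain ⟨z, hz, rfl⟩ := CoreCoset.isCore_iff.1 hp
    rw [hz.Sq_dcoset]
    exact hz.bijOn_sqExpr (hz.ncard_eq.trans hm)
  · intro I J K r p q hm hp hq hr
    obtain ⟨z, hz, rfl⟩ := CoreCoset.isCore_iff.1 hp
    obtain ⟨z', hz', rfl⟩ := CoreCoset.isCore_iff.1 hq
    obtain ⟨hadd, rfl⟩ := hz.lenAdd_and_eq_of_isReducedProd hz' hr
    have hmK : K.ncard = m := hz'.ncard_eq.symm.trans hm
    rw [(hz.mul hz').Sq_dcoset, hz.Sq_dcoset, hz'.Sq_dcoset]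
    exact ⟨(hz.mul hz').isCore, hz.squash_mul hz' hmK,
      (hz.lenAdd_iff_lenAdd_squash hz' hmK).1 hadd⟩
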